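/- Let $\Gamma$ be a finite group, and let $C(\Gamma)$ be the space of complex class functions on $\Gamma$. A $\Gamma$-Hilbert module is a finite-dimensional complex Hilbert space with a unitary action of $\Gamma$. **Torsion of complexes.** For a $\Gamma$-equivariant isomorphism $f:V\to W$ of $\Gamma$-Hilbert modules and an irreducible representation $\pi$ of $\Gamma$ let $f(\pi):V(\pi)\to W(\pi)$ be the induced map of $\pi$-isotypic components, and put $$[[f]](\pi)=\frac{1}{2\dim\pi}\log\left|\det\left(f(\pi)^*f(\pi)\right)\right| ,\qquad \mathcal X[[f]]=\sum_{\pi}[[f]](\pi)\,\chi_\pi\in C(\Gamma),$$ where $\pi$ runs over the isomorphism classes of irreducible representations and $\chi_\pi$ is the character of $\pi$. If $(\mathcal C,c)$ is a finite acyclic cochain complex of $\Gamma$-Hilbert modules, with equivariant differential, choose an equivariant chain contraction $\kappa:C^*\to C^{*-1}$ and put $$\rho(\mathcal C)=\mathcal X[[\,c+\kappa: C^{ev}\to C^{odd}\,]] ,$$ which does not depend on $\kappa$. If $\mathcal C$ is any finite cochain complex of $\Gamma$-Hilbert modules together with a $\Gamma$-Hilbert module structure on $H^*(\mathcal C)$,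 let $\mathcal H(\mathcal C)$ be $H^*(\mathcal C)$ regarded as a complex with zero differential, choose an equivariant embedding of complexes $i:\mathcal H(\mathcal C)\to\mathcal C$ inducing the identity on cohomology, and put $\rho(\mathcal C)=-\rho(\mathrm{cone}(i))$, which does not depend on $i$. Here the cone of a chain map $g:(\mathcal B,b)\to(\mathcal C,c)$ has the modules $\mathrm{cone}(g)^n=B^n\oplus C^{n-1}$ and the differential $(x,y)\mapsto(b x,\,g x-c y)$. **Torsion of spaces.** Let $X$ be a $\Gamma$-space of the homotopy type of a finite $\Gamma$-CW-complex, with a simple structure represented by a pair $(Z,f)$, where $Z$ is a finite $\Gamma$-CW-complex and $f:Z\to X$ is a $\Gamma$-homotopy equivalence. Let $\mathcal F$ be a $\Gamma$-equivariant locally constant sheaf of finite-dimensional Hilbert spaces on $X$, and fix a $\Gamma$-Hilbert module structure on $H^*(X,\mathcal F)$. Let $\mathcal C(Z,f^*\mathcal F)$ be the cellular cochain complex, with $n$-th module $H^n(Z_n,Z_{n-1};f^*\mathcal F)$, which is a $\Gamma$-Hilbert module as the orthogonal sum over the $n$-cells of the stalks of $f^*\mathcal F$. Give $H^*(\mathcal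 C(Z,f^*\mathcal F))$ the inner products for which the canonical isomorphism $f^*:H^*(X,\mathcal F)\to H^*(\mathcal C(Z,f^*\mathcal F))$ is an isometry. The equivariant Reidemeister torsion of $X$ with these data is $$\rho(X,\mathcal F)=\rho(\mathcal C(Z,f^*\mathcal F))\in C(\Gamma).$$ **Restriction.** Let $\Gamma'\subseteq\Gamma$ be a subgroup. Let $\mathrm{res}^\Gamma_{\Gamma'}X$ be $X$ as a $\Gamma'$-space, with the simple structure represented by $(\mathrm{res}^\Gamma_{\Gamma'}Z,f)$, where the $\Gamma'$-CW-structure has the same cells; regard $\mathcal F$ as a $\Gamma'$-equivariant sheaf, and use the same inner products on $H^*(\mathrm{res}^\Gamma_{\Gamma'}X,\mathcal F)=\mathrm{res}^\Gamma_{\Gamma'}H^*(X,\mathcal F)$. Let also $\mathrm{res}^\Gamma_{\Gamma'}:C(\Gamma)\to C(\Gamma')$ be the restriction of class functions. Then $$\mathrm{res}^\Gamma_{\Gamma'}\,\rho(X,\mathcal F)=\rho(\mathrm{res}^\Gamma_{\Gamma'}X,\mathcal F)\quad\text{in } C(\Gamma').$$ -/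

import Mathlib

universe u v w

noncomputable section

open Topology Set

/-- The étalé space of a family of stalks: the disjoint union of the stalks, without its sum
topology. -/
structure Etale {X : Type u} (stalk : X → Type v) where
  base : X
  val : stalk base

/-- A locally constant sheaf of finite-dimensional Hilbert spaces on `X`, given by its étalé space:
a topology on the disjoint union of the stalks such that near every point `x` the stalks are
identified with the Hilbert space `stalk x`, the sections which are constant for this
identification being homeomorphisms onto open subsets of the étalé space. -/
structure HilbertLocalSystem (X : Type u) [TopologicalSpace X] where
  stalk : X → Type v
  [normedAddCommGroup : ∀ x, NormedAddCommGroup (stalk x)]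
  [innerProductSpace : ∀ x, InnerProductSpace ℂ (stalk x)]
  [finiteDimensional : ∀ x, FiniteDimensional ℂ (stalk x)]
  [topology : TopologicalSpace (Etale stalk)]
  locally_constant : ∀ x, ∃ U : Set X, IsOpen U ∧ x ∈ U ∧
    ∃ τ : ∀ y : U, stalk x ≃ₗᵢ[ℂ] stalk y,
      ∀ v : stalk x, IsOpenEmbedding (fun y : U => (⟨y, τ y v⟩ : Etale stalk))

attribute [instance] HilbertLocalSystem.normedAddCommGroup HilbertLocalSystem.innerProductSpace
  HilbertLocalSystem.finiteDimensional HilbertLocalSystem.topology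

namespace HilbertLocalSystem

variable {X : Type u} [TopologicalSpace X] (F : HilbertLocalSystem.{u, v} X)

theorem mk_inj {x : X} {v w : F.stalk x}
    (h : (⟨x, v⟩ : Etale F.stalk) = ⟨x, w⟩) : v = w := by
  cases h; rfl

/-- The isometry of stalks induced by an equality of points. -/
def castEquiv {x y : X} (h : x = y) : F.stalk x ≃ₗᵢ[ℂ] F.stalk y :=
  h ▸ LinearIsometryEquiv.refl ℂ (F.stalk x)

theorem mk_castEquiv {x y : X} (h : x = y) (v : F.stalk x) :
    (⟨y, F.castEquiv h v⟩ : Etale F.stalk) = ⟨x, v⟩ := by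
  subst h; rfl

/-- The continuity criterion for sections along a map `σ` at a point. -/
theorem continuousAt_iff {A : Type w} [TopologicalSpace A] {σ : A → X} (hσ : Continuous σ)
    (s : ∀ t, F.stalk (σ t)) (t₀ : A) {x : X} {U : Set X} (hU : IsOpen U)
    (τ : ∀ y : U, F.stalk x ≃ₗᵢ[ℂ] F.stalk y)
    (hτ : ∀ v : F.stalk x, IsOpenEmbedding (fun y : U => (⟨y, τ y v⟩ : Etale F.stalk)))
    (v : F.stalk x) (ht : σ t₀ ∈ U) (hv : s t₀ = τ ⟨σ t₀, ht⟩ v) :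
    ContinuousAt (fun t => (⟨σ t, s t⟩ : Etale F.stalk)) t₀ ↔
      ∀ᶠ t in 𝓝 t₀, ∃ h : σ t ∈ U, s t = τ ⟨σ t, h⟩ v := by
  constructor
  · intro hc
    have hmem : (⟨σ t₀, s t₀⟩ : Etale F.stalk) ∈ range (fun y : U => (⟨y, τ y v⟩ : Etale F.stalk)) :=
      ⟨⟨σ t₀, ht⟩, by rw [hv]⟩
    filter_upwards [hc.eventually ((hτ v).isOpen_range.mem_nhds hmem)] with t hts
    obtain ⟨⟨y, hy⟩, he⟩ := hts
    have h1 : y = σ t := congrArg Etale.base he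
    subst h1
    exact ⟨hy, (F.mk_inj he).symm⟩
  · intro h
    have hUo : σ ⁻¹' U ∈ 𝓝 t₀ := (hU.preimage hσ).mem_nhds ht
    have hc : ContinuousAt (fun t : σ ⁻¹' U => (⟨σ t, τ ⟨σ t, t.2⟩ v⟩ : Etale F.stalk)) ⟨t₀, ht⟩ := by
      have : Continuous (fun t : σ ⁻¹' U => (⟨σ t, t.2⟩ : U)) := by fun_prop
      exact ((hτ v).continuous.comp this).continuousAt
    have hoe : IsOpenEmbedding (Subtype.val : σ ⁻¹' U → A) :=
      (hU.preimage hσ).isOpenEmbedding_subtypeVal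
    have key := hoe.continuousAt_iff (f := Subtype.val) (g := fun t => (⟨σ t, s t⟩ : Etale F.stalk))
      (x := ⟨t₀, ht⟩)
    rw [← key]
    refine hc.congr ?_
    have := hoe.continuous.continuousAt (x := ⟨t₀, ht⟩) |>.eventually h
    filter_upwards [this] with t ht2
    obtain ⟨h3, h4⟩ := ht2
    simp [h4]

/-- The space `H⁰(A, σ^*F)` of global sections of the pull-back of the sheaf along `σ`: families of
elements of the stalks which are continuous as maps to the étalé space. -/
def sections {A : Type w} [TopologicalSpace A] (σ : C(A, X)) :
    Submodule ℂ (∀ t : A, F.stalk (σ t)) where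
  carrier := {s | Continuous fun t => (⟨σ t, s t⟩ : Etale F.stalk)}
  zero_mem' := by
    refine continuous_iff_continuousAt.2 fun t₀ => ?_
    obtain ⟨U, hU, hx, τ, hτ⟩ := F.locally_constant (σ t₀)
    refine (F.continuousAt_iff σ.continuous _ t₀ hU τ hτ 0 hx (by simp)).2 ?_
    filter_upwards [(hU.preimage σ.continuous).mem_nhds hx] with t ht using ⟨ht, by simp⟩
  add_mem' := by
    intro a b ha hb
    refine continuous_iff_continuousAt.2 fun t₀ => ?_
    obtain ⟨U, hU, hx, τ, hτ⟩ := F.locally_constant (σ t₀)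
    have h1 := (F.continuousAt_iff σ.continuous a t₀ hU τ hτ ((τ ⟨σ t₀, hx⟩).symm (a t₀)) hx
      (by simp)).1 (continuous_iff_continuousAt.1 ha t₀)
    have h2 := (F.continuousAt_iff σ.continuous b t₀ hU τ hτ ((τ ⟨σ t₀, hx⟩).symm (b t₀)) hx
      (by simp)).1 (continuous_iff_continuousAt.1 hb t₀)
    refine (F.continuousAt_iff σ.continuous _ t₀ hU τ hτ
      ((τ ⟨σ t₀, hx⟩).symm (a t₀) + (τ ⟨σ t₀, hx⟩).symm (b t₀)) hx (by simp)).2 ?_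
    filter_upwards [h1, h2] with t h1 h2
    obtain ⟨ht, h1⟩ := h1
    obtain ⟨_, h2⟩ := h2
    exact ⟨ht, by simp [h1, h2]⟩
  smul_mem' := by
    intro c a ha
    refine continuous_iff_continuousAt.2 fun t₀ => ?_
    obtain ⟨U, hU, hx, τ, hτ⟩ := F.locally_constant (σ t₀)
    have h1 := (F.continuousAt_iff σ.continuous a t₀ hU τ hτ ((τ ⟨σ t₀, hx⟩).symm (a t₀)) hx
      (by simp)).1 (continuous_iff_continuousAt.1 ha t₀)
    refine (F.continuousAt_iff σ.continuous _ t₀ hU τ hτ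
      (c • (τ ⟨σ t₀, hx⟩).symm (a t₀)) hx (by simp)).2 ?_
    filter_upwards [h1] with t h1
    obtain ⟨ht, h1⟩ := h1
    exact ⟨ht, by simp [h1]⟩

theorem isEvenlyCovered_base (x : X) (ι : Type v) [TopologicalSpace ι] [DiscreteTopology ι]
    (e : ι ≃ F.stalk x) : IsEvenlyCovered (Etale.base : Etale F.stalk → X) x ι := by
  obtain ⟨U, hU, hx, τ, hτ⟩ := F.locally_constant x
  have : Nonempty ι := ⟨e.symm 0⟩
  have : Nonempty (X → Etale F.stalk) := ⟨fun y => ⟨y, 0⟩⟩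
  let S : ι → Set (Etale F.stalk) := fun i => range (fun y : U => (⟨y, τ y (e i)⟩ : Etale F.stalk))
  refine IsEvenlyCovered.of_trivialization
    (t := IsOpen.trivializationDiscrete (f := Etale.base) S U hU ?_ ?_ ?_ ?_ ?_) hx
  · intro i W hW
    have him : Etale.base ⁻¹' W ∩ S i =
        (fun y : U => (⟨y, τ y (e i)⟩ : Etale F.stalk)) '' (Subtype.val ⁻¹' W) := by
      ext p
      constructor
      · rintro ⟨hp, y, rfl⟩
        exact ⟨y, hp, rfl⟩
      · rintro ⟨y, hy, rfl⟩
        exact ⟨hy, y, rfl⟩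
    rw [him, ← (hτ (e i)).isOpen_iff_image_isOpen, hU.isOpenEmbedding_subtypeVal.isOpen_iff_image_isOpen,
      Subtype.image_preimage_coe, inter_eq_right.2 hW]
  · rintro i _ ⟨y, rfl⟩ _ ⟨z, rfl⟩ h
    obtain rfl : y = z := Subtype.ext h
    rfl
  · intro i y hy
    exact ⟨_, ⟨⟨y, hy⟩, rfl⟩, rfl⟩
  · intro i j hij
    refine disjoint_left.2 ?_
    rintro _ ⟨y, rfl⟩ ⟨z, hz⟩
    obtain rfl : z = y := Subtype.ext (congrArg Etale.base hz)
    exact hij (e.injective ((τ z).injective (F.mk_inj hz))).symm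
  · rintro ⟨y, v⟩ hy
    refine mem_iUnion.2 ⟨e.symm ((τ ⟨y, hy⟩).symm v), ⟨y, hy⟩, ?_⟩
    simp

theorem isCoveringMap_base : IsCoveringMap (Etale.base : Etale F.stalk → X) := by
  intro x
  obtain ⟨ι, ⟨e⟩⟩ : ∃ ι : Type v, Nonempty (ι ≃ F.stalk x) := ⟨_, ⟨Equiv.refl _⟩⟩
  let _ : TopologicalSpace ι := ⊥
  have : DiscreteTopology ι := ⟨rfl⟩
  exact (F.isEvenlyCovered_base x ι e).to_isEvenlyCovered_preimage

theorem continuous_base : Continuous (Etale.base : Etale F.stalk → X) :=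
  F.isCoveringMap_base.continuous

/-- Over a simply connected and locally path connected space, a section is determined by its value
at a point, which can be prescribed. -/
theorem bijective_eval {A : Type w} [TopologicalSpace A] [SimplyConnectedSpace A]
    [LocallyPathConnectedSpace A] (σ : C(A, X)) (a : A) :
    Function.Bijective (fun s : F.sections σ => (s : ∀ t, F.stalk (σ t)) a) := by
  constructor
  · intro s s' h
    have hu := F.isCoveringMap_base.existsUnique_continuousMap_lifts σ a ⟨σ a, s.1 a⟩ rfl
    have := hu.unique (y₁ := ⟨fun t => ⟨σ t, s.1 t⟩, s.2⟩) (y₂ := ⟨fun t => ⟨σ t, s'.1 t⟩, s'.2⟩)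
      ⟨rfl, rfl⟩ ⟨congrArg (Etale.mk (σ a)) h.symm, rfl⟩
    refine Subtype.ext (funext fun t => F.mk_inj ?_)
    exact DFunLike.congr_fun this t
  · intro v
    obtain ⟨L, ⟨h1, h2⟩, -⟩ :=
      F.isCoveringMap_base.existsUnique_continuousMap_lifts σ a ⟨σ a, v⟩ rfl
    have hb : ∀ t, (L t).base = σ t := fun t => congrFun h2 t
    have hL : ∀ t, (⟨σ t, F.castEquiv (hb t) (L t).val⟩ : Etale F.stalk) = L t := fun t =>
      F.mk_castEquiv (hb t) _
    refine ⟨⟨fun t => F.castEquiv (hb t) (L t).val, ?_⟩, ?_⟩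
    · change Continuous fun t => (⟨σ t, F.castEquiv (hb t) (L t).val⟩ : Etale F.stalk)
      simp_rw [hL]
      exact L.continuous
    · exact F.mk_inj ((hL a).trans h1)

end HilbertLocalSystem

/-! ### Singular cochains with local coefficients -/

/-- The standard `n`-simplex. -/
abbrev Simplex (n : ℕ) : Type := stdSimplex ℝ (Fin (n + 1))

instance (n : ℕ) : SimplyConnectedSpace (Simplex n) :=
  have : ContractibleSpace (Simplex n) :=
    (convex_stdSimplex ℝ (Fin (n + 1))).contractibleSpace
      ⟨_, (stdSimplex.vertex (S := ℝ) (0 : Fin (n + 1))).2⟩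
  inferInstance

instance (n : ℕ) : LocallyPathConnectedSpace (Simplex n) :=
  (convex_stdSimplex ℝ (Fin (n + 1))).locallyPathConnectedSpace

/-- The inclusion of the `i`-th face. -/
def faceMap {n : ℕ} (i : Fin (n + 2)) : C(Simplex n, Simplex (n + 1)) :=
  ⟨stdSimplex.map i.succAbove, stdSimplex.continuous_map _⟩

theorem faceMap_faceMap {n : ℕ} {i j : Fin (n + 2)} (h : i ≤ j) (t : Simplex n) :
    faceMap j.succ (faceMap i t) = faceMap i.castSucc (faceMap j t) := by
  change stdSimplex.map _ (stdSimplex.map _ t) = stdSimplex.map _ (stdSimplex.map _ t)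
  rw [stdSimplex.map_comp_apply, stdSimplex.map_comp_apply]
  congr 1
  funext k
  simp only [Function.comp_apply, Fin.succAbove, Fin.lt_def, Fin.le_def, Fin.ext_iff] at h ⊢
  split_ifs <;> simp_all <;> omega

theorem faceMap_apply_self {n : ℕ} (i : Fin (n + 2)) (t : Simplex n) : faceMap i t i = 0 := by
  change stdSimplex.map _ t i = 0
  rw [stdSimplex.map_coe, FunOnFinite.linearMap_apply_apply]
  refine Finset.sum_eq_zero fun j hj => ?_
  exact absurd (Finset.mem_filter.1 hj).2 (Fin.succAbove_ne i j)

namespace HilbertLocalSystem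

variable {X : Type u} [TopologicalSpace X] (F : HilbertLocalSystem.{u, v} X)

/-- Restriction of sections along a continuous map. -/
def restrict {A B : Type w} [TopologicalSpace A] [TopologicalSpace B] (σ : C(B, X)) (α : C(A, B)) :
    F.sections σ →ₗ[ℂ] F.sections (σ.comp α) where
  toFun s := ⟨fun t => s.1 (α t), Continuous.comp s.2 α.continuous⟩
  map_add' _ _ := rfl
  map_smul' _ _ := rfl

/-- The sections over a simplex are identified with the sections over any of its faces. -/
def faceEquiv {n : ℕ} (σ : C(Simplex (n + 1), X)) (i : Fin (n + 2)) :
    F.sections σ ≃ₗ[ℂ] F.sections (σ.comp (faceMap i)) :=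
  LinearEquiv.ofBijective (F.restrict σ (faceMap i)) <| by
    have h1 := F.bijective_eval σ (faceMap i (stdSimplex.vertex (S := ℝ) (0 : Fin (n + 1))))
    have h2 := F.bijective_eval (σ.comp (faceMap i)) (stdSimplex.vertex (S := ℝ) (0 : Fin (n + 1)))
    exact (Function.Bijective.of_comp_iff' h2 _).1 h1

/-- Singular `n`-cochains on `X` with values in `F`: they assign to every singular simplex `σ` a
section of `F` along `σ`. -/
def Cochain (n : ℕ) : Type (max u v) := ∀ σ : C(Simplex n, X), F.sections σ

instance (n : ℕ) : AddCommGroup (F.Cochain n) :=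
  inferInstanceAs (AddCommGroup (∀ σ : C(Simplex n, X), F.sections σ))

instance (n : ℕ) : Module ℂ (F.Cochain n) :=
  inferInstanceAs (Module ℂ (∀ σ : C(Simplex n, X), F.sections σ))

@[simp] theorem Cochain.zero_apply {n : ℕ} (σ : C(Simplex n, X)) : (0 : F.Cochain n) σ = 0 := rfl

@[simp] theorem Cochain.add_apply {n : ℕ} (φ ψ : F.Cochain n) (σ : C(Simplex n, X)) :
    (φ + ψ) σ = φ σ + ψ σ := rfl

@[simp] theorem Cochain.smul_apply {n : ℕ} (c : ℂ) (φ : F.Cochain n) (σ : C(Simplex n, X)) :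
    (c • φ) σ = c • φ σ := rfl

theorem Cochain.sum_apply {n : ℕ} {ι : Type*} (s : Finset ι) (φ : ι → F.Cochain n)
    (σ : C(Simplex n, X)) : (∑ i ∈ s, φ i) σ = ∑ i ∈ s, φ i σ :=
  map_sum (AddMonoidHom.mk' (fun φ : F.Cochain n => φ σ) fun _ _ => rfl) φ s

/-- The value of `coface i φ` on `σ` is the extension to `σ` of the value of `φ` on the `i`-th face
of `σ`. -/
def coface {n : ℕ} (i : Fin (n + 2)) : F.Cochain n →ₗ[ℂ] F.Cochain (n + 1) where
  toFun φ σ := (F.faceEquiv σ i).symm (φ (σ.comp (faceMap i)))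
  map_add' _ _ := funext fun σ => map_add (F.faceEquiv σ i).symm _ _
  map_smul' c _ := funext fun σ => map_smul (F.faceEquiv σ i).symm c _

theorem coface_apply {n : ℕ} (i : Fin (n + 2)) (φ : F.Cochain n) (σ : C(Simplex (n + 1), X)) :
    F.coface i φ σ = (F.faceEquiv σ i).symm (φ (σ.comp (faceMap i))) := rfl

theorem coface_apply_face {n : ℕ} (i : Fin (n + 2)) (φ : F.Cochain n) (σ : C(Simplex (n + 1), X))
    (t : Simplex n) :
    (F.coface i φ σ).1 (faceMap i t) = (φ (σ.comp (faceMap i))).1 t := by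
  have := (F.faceEquiv σ i).apply_symm_apply (φ (σ.comp (faceMap i)))
  exact congrFun (congrArg Subtype.val this) t

theorem cochain_ext {n : ℕ} {φ ψ : F.Cochain n}
    (h : ∀ σ, ∃ t, (φ σ).1 t = (ψ σ).1 t) : φ = ψ := by
  funext σ
  obtain ⟨t, ht⟩ := h σ
  exact (F.bijective_eval σ t).1 ht

/-- The coboundary operator. -/
def δ (n : ℕ) : F.Cochain n →ₗ[ℂ] F.Cochain (n + 1) :=
  ∑ i : Fin (n + 2), (-1 : ℂ) ^ (i : ℕ) • F.coface i

theorem mk_congr {n : ℕ} (φ : F.Cochain n) {σ σ' : C(Simplex n, X)} (h : σ = σ') (t : Simplex n) :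
    (⟨σ t, (φ σ).1 t⟩ : Etale F.stalk) = ⟨σ' t, (φ σ').1 t⟩ := by
  subst h; rfl

theorem mk_congr' {n : ℕ} (φ : F.Cochain n) (σ : C(Simplex n, X)) {t t' : Simplex n} (h : t = t') :
    (⟨σ t, (φ σ).1 t⟩ : Etale F.stalk) = ⟨σ t', (φ σ).1 t'⟩ := by
  subst h; rfl

theorem coface_coface {n : ℕ} {i j : Fin (n + 2)} (h : i ≤ j) (φ : F.Cochain n) :
    F.coface j.succ (F.coface i φ) = F.coface i.castSucc (F.coface j φ) := by
  refine F.cochain_ext fun σ => ?_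
  let t : Simplex n := stdSimplex.vertex (S := ℝ) (0 : Fin (n + 1))
  refine ⟨faceMap j.succ (faceMap i t), F.mk_inj ?_⟩
  rw [F.mk_congr' (F.coface i.castSucc (F.coface j φ)) σ (faceMap_faceMap h t),
    F.coface_apply_face, F.coface_apply_face, F.coface_apply_face, F.coface_apply_face]
  refine F.mk_congr φ (σ := (σ.comp (faceMap j.succ)).comp (faceMap i))
    (σ' := (σ.comp (faceMap i.castSucc)).comp (faceMap j)) ?_ t
  ext t
  simp [faceMap_faceMap h]

theorem δ_δ {n : ℕ} (φ : F.Cochain n) : F.δ (n + 1) (F.δ n φ) = 0 := by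
  simp only [δ, LinearMap.sum_apply, LinearMap.smul_apply, map_sum, map_smul, Finset.smul_sum,
    smul_smul]
  rw [← Finset.sum_product']
  let P := Fin (n + 2) × Fin (n + 3)
  let S : Finset P := {ij : P | (ij.2 : ℕ) ≤ (ij.1 : ℕ)}
  rw [Finset.univ_product_univ, ← Finset.sum_add_sum_compl S, ← eq_neg_iff_add_eq_zero,
    ← Finset.sum_neg_distrib]
  let f : ∀ ij : P, ij ∈ S → P := fun ij hij =>
    (Fin.castLT ij.2 (lt_of_le_of_lt (Finset.mem_filter.mp hij).right (Fin.is_lt ij.1)), ij.1.succ)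
  apply Finset.sum_bij f
  · intro ij hij
    simp_rw [S, f, Finset.compl_filter, Finset.mem_filter_univ, Fin.val_succ,
      Fin.val_castLT] at hij ⊢
    lia
  · rintro ⟨i, j⟩ hij ⟨i', j'⟩ hij' h
    rw [Prod.mk_inj]
    exact ⟨by simpa [f] using! congr_arg Prod.snd h,
      by simpa [f, Fin.castSucc_castLT] using! congr_arg Fin.castSucc (congr_arg Prod.fst h)⟩
  · rintro ⟨i', j'⟩ hij'
    simp_rw [S, Finset.compl_filter, Finset.mem_filter_univ, not_le] at hij'
    refine ⟨(j'.pred ?_, Fin.castSucc i'), ?_, ?_⟩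
    · rintro rfl
      simp only [Fin.val_zero, not_lt_zero] at hij'
    · simpa [S] using! Nat.le_sub_one_of_lt hij'
    · simp only [f, Fin.castLT_castSucc, Fin.succ_pred]
  · rintro ⟨i, j⟩ hij
    have hij2 : (j : ℕ) ≤ i := by simpa [S] using! hij
    have h := F.coface_coface (i := Fin.castLT j (lt_of_le_of_lt hij2 i.2)) (j := i)
      (by simpa [Fin.le_def] using! hij2) φ
    rw [Fin.castSucc_castLT] at h
    simp only [f, h, Fin.val_succ, Fin.val_castLT]
    rw [← neg_smul]
    congr 1
    ring

/-- Cochains vanishing on the singular simplices of the subspace `A`. -/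
def vanishing (A : Set X) (n : ℕ) : Submodule ℂ (F.Cochain n) where
  carrier := {φ | ∀ σ : C(Simplex n, X), (∀ t, σ t ∈ A) → φ σ = 0}
  zero_mem' _ _ := rfl
  add_mem' ha hb σ hσ := by simp [ha σ hσ, hb σ hσ]
  smul_mem' c a ha σ hσ := by simp [ha σ hσ]

/-- Cochains on `X` restricting to relative cocycles of the pair `(B, A)`. -/
def relCocycles (B A : Set X) (n : ℕ) : Submodule ℂ (F.Cochain n) :=
  F.vanishing A n ⊓ (F.vanishing B (n + 1)).comap (F.δ n)

/-- The coboundaries of the cochains vanishing on `A`. -/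
def coboundaries (A : Set X) : ∀ n : ℕ, Submodule ℂ (F.Cochain n)
  | 0 => ⊥
  | n + 1 => (F.vanishing A n).map (F.δ n)

/-- Cochains on `X` restricting to relative coboundaries of the pair `(B, A)`. -/
def relCoboundaries (B A : Set X) (n : ℕ) : Submodule ℂ (F.Cochain n) :=
  F.vanishing B n ⊔ F.coboundaries A n

/-- The singular cohomology `Hⁿ(B, A; F)` of a pair `A ⊆ B` of subspaces of `X`. Cochains on `B`
vanishing on `A` are represented by cochains on `X` vanishing on `A`, two of which restrict to the
same cochain on `B` if their difference vanishes on `B`. -/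
abbrev RelCohomology (B A : Set X) (n : ℕ) : Type (max u v) :=
  F.relCocycles B A n ⧸ (F.relCoboundaries B A n).submoduleOf (F.relCocycles B A n)

/-- The cohomology `Hⁿ(X; F)`. -/
abbrev Cohomology (n : ℕ) : Type (max u v) := F.RelCohomology univ ∅ n

theorem δ_mem_vanishing {A : Set X} {n : ℕ} {φ : F.Cochain n} (h : φ ∈ F.vanishing A n) :
    F.δ n φ ∈ F.vanishing A (n + 1) := by
  intro σ hσ
  simp only [δ, LinearMap.sum_apply, LinearMap.smul_apply, Cochain.sum_apply,
    Cochain.smul_apply]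
  refine Finset.sum_eq_zero fun i _ => ?_
  rw [coface_apply, h (σ.comp (faceMap i)) fun t => hσ _, map_zero, smul_zero]

theorem δ_mem_relCocycles {A B C : Set X} {n : ℕ} {φ : F.Cochain n}
    (h : φ ∈ F.relCocycles B A n) : F.δ n φ ∈ F.relCocycles C B (n + 1) :=
  ⟨h.2, by simp [δ_δ]⟩

/-- The connecting map `Hⁿ(B, A; F) → Hⁿ⁺¹(C, B; F)` of a triple `A ⊆ B ⊆ C`. -/
def connecting (C B A : Set X) (n : ℕ) :
    F.RelCohomology B A n →ₗ[ℂ] F.RelCohomology C B (n + 1) :=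
  Submodule.mapQ _ _ ((F.δ n).restrict fun _ h => F.δ_mem_relCocycles h) <| by
    rintro ⟨φ, hφ⟩ h
    obtain ⟨ψ, hψ, η, hη, rfl⟩ := Submodule.mem_sup.1 (show φ ∈ F.relCoboundaries B A n from h)
    have h0 : F.δ n η = 0 := by
      cases n with
      | zero => rw [show η = 0 from hη, map_zero]
      | succ n =>
        obtain ⟨ζ, -, rfl⟩ := hη
        exact F.δ_δ ζ
    refine Submodule.mem_sup_right (?_ : F.δ n (ψ + η) ∈ (F.vanishing B n).map (F.δ n))
    rw [map_add, h0, add_zero]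
    exact Submodule.mem_map_of_mem hψ

end HilbertLocalSystem

/-! ### Pull-backs and equivariant structures -/

namespace HilbertLocalSystem

section Pullback

variable {X : Type u} [TopologicalSpace X] {Z : Type w} [TopologicalSpace Z]

/-- The inverse image `f^*F`, whose étalé space is the fibre product of `Z` and the étalé space
of `F`. -/
def pullback (F : HilbertLocalSystem.{u, v} X) (f : C(Z, X)) : HilbertLocalSystem.{w, v} Z :=
  letI top : TopologicalSpace (Etale fun z => F.stalk (f z)) :=
    TopologicalSpace.induced
      (fun e => (e.base, (⟨f e.base, e.val⟩ : Etale F.stalk))) inferInstance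
  { stalk := fun z => F.stalk (f z)
    topology := top
    locally_constant := by
      intro z
      obtain ⟨U, hU, hx, τ, hτ⟩ := F.locally_constant (f z)
      refine ⟨f ⁻¹' U, hU.preimage f.continuous, hx, fun y => τ ⟨f y, y.2⟩, fun v => ?_⟩
      have hj : Continuous fun e : Etale fun z => F.stalk (f z) =>
          (e.base, (⟨f e.base, e.val⟩ : Etale F.stalk)) := continuous_induced_dom
      have hm : Continuous fun y : f ⁻¹' U =>
          (⟨y, τ ⟨f y, y.2⟩ v⟩ : Etale fun z => F.stalk (f z)) := by
        refine continuous_induced_rng.2 ?_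
        refine continuous_subtype_val.prodMk ?_
        have : Continuous (fun y : f ⁻¹' U => (⟨f y, y.2⟩ : U)) := by fun_prop
        exact (hτ v).continuous.comp this
      refine ⟨IsEmbedding.of_comp hm (continuous_fst.comp hj) IsEmbedding.subtypeVal, ?_⟩
      convert! ((continuous_snd.comp hj).isOpen_preimage _ (hτ v).isOpen_range) using 1
      ext ⟨y, w⟩
      constructor
      · rintro ⟨y', h⟩
        cases h
        exact ⟨⟨f y', y'.2⟩, rfl⟩
      · rintro ⟨⟨x, hx'⟩, h⟩
        obtain rfl : x = f y := congrArg Etale.base h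
        exact ⟨⟨y, hx'⟩, congrArg (Etale.mk y) (F.mk_inj h)⟩ }

variable (F : HilbertLocalSystem.{u, v} X) (f : C(Z, X))

theorem continuous_pullback_iff {A : Type*} [TopologicalSpace A] {g : A → Etale (F.pullback f).stalk} :
    Continuous g ↔ Continuous (fun a => (g a).base) ∧
      Continuous fun a => (⟨f (g a).base, (g a).val⟩ : Etale F.stalk) :=
  continuous_induced_rng.trans
    (continuous_prodMk (f := fun a => (g a).base)
      (g := fun a => (⟨f (g a).base, (g a).val⟩ : Etale F.stalk)))

/-- The map `f^*` on cochains. -/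
def pullbackCochain (n : ℕ) : F.Cochain n →ₗ[ℂ] (F.pullback f).Cochain n where
  toFun φ σ := ⟨(φ (f.comp σ)).1,
    (F.continuous_pullback_iff f).2 ⟨σ.continuous, (φ (f.comp σ)).2⟩⟩
  map_add' _ _ := rfl
  map_smul' _ _ := rfl

end Pullback

section Equivariant

variable {X : Type u} [TopologicalSpace X]

/-- The structure of a `Γ`-equivariant sheaf on `F`: a continuous action on the étalé space by
isometries of stalks which covers the action on `X`. -/
structure EquivariantStructure (Γ : Type w) [Group Γ] [MulAction Γ X]
    (F : HilbertLocalSystem.{u, v} X) where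
  act : ∀ (γ : Γ) (x : X), F.stalk x ≃ₗᵢ[ℂ] F.stalk (γ • x)
  one_act : ∀ (x : X) (v : F.stalk x), (⟨(1 : Γ) • x, act 1 x v⟩ : Etale F.stalk) = ⟨x, v⟩
  mul_act : ∀ (γ γ' : Γ) (x : X) (v : F.stalk x),
    (⟨(γ * γ') • x, act (γ * γ') x v⟩ : Etale F.stalk) =
      ⟨γ • γ' • x, act γ (γ' • x) (act γ' x v)⟩
  continuous_act : ∀ γ : Γ, Continuous fun e : Etale F.stalk =>
    (⟨γ • e.base, act γ e.base e.val⟩ : Etale F.stalk)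

namespace EquivariantStructure

variable {Γ : Type w} [Group Γ] [MulAction Γ X] {F : HilbertLocalSystem.{u, v} X}
  (E : F.EquivariantStructure Γ)

/-- Restriction of the equivariant structure to a subgroup. -/
def res (Γ' : Subgroup Γ) : F.EquivariantStructure Γ' where
  act γ x := E.act (γ : Γ) x
  one_act := E.one_act
  mul_act γ γ' := E.mul_act (γ : Γ) (γ' : Γ)
  continuous_act γ := E.continuous_act (γ : Γ)

/-- The action of `γ` as a map from the stalk at `x` to the stalk at `y = γ • x`. -/
def actTo (γ : Γ) {x y : X} (h : γ • x = y) : F.stalk x ≃ₗᵢ[ℂ] F.stalk y :=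
  (E.act γ x).trans (F.castEquiv h)

/-- The action of `γ` on the étalé space. -/
def actEtale (γ : Γ) (e : Etale F.stalk) : Etale F.stalk := ⟨γ • e.base, E.act γ e.base e.val⟩

theorem actEtale_one (e : Etale F.stalk) : E.actEtale 1 e = e := E.one_act e.base e.val

theorem actEtale_mul (γ γ' : Γ) (e : Etale F.stalk) :
    E.actEtale (γ * γ') e = E.actEtale γ (E.actEtale γ' e) := E.mul_act γ γ' e.base e.val

theorem mk_actTo (γ : Γ) {x y : X} (h : γ • x = y) (v : F.stalk x) :
    (⟨y, E.actTo γ h v⟩ : Etale F.stalk) = E.actEtale γ ⟨x, v⟩ :=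
  F.mk_castEquiv h _

/-- The equivariant structure of the inverse image along an equivariant map. -/
def pullback {Z : Type*} [TopologicalSpace Z] [MulAction Γ Z] [ContinuousConstSMul Γ Z]
    (f : C(Z, X)) (hf : ∀ (γ : Γ) z, f (γ • z) = γ • f z) :
    (F.pullback f).EquivariantStructure Γ where
  act γ z := E.actTo γ (hf γ z).symm
  one_act z v := by
    have h1 : (1 : Γ) • z = z := one_smul _ z
    have key : ∀ (z' : Z) (h : z' = z) (v' : F.stalk (f z')),
        (⟨f z', v'⟩ : Etale F.stalk) = ⟨f z, v⟩ →
          (⟨z', v'⟩ : Etale (F.pullback f).stalk) = ⟨z, v⟩ := by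
      rintro z' rfl v' h
      exact congrArg (Etale.mk _) (F.mk_inj h)
    exact key _ h1 _ ((E.mk_actTo 1 (hf 1 z).symm v).trans (E.actEtale_one _))
  mul_act γ γ' z v := by
    have key : ∀ (z' z'' : Z) (h : z' = z'') (v' : F.stalk (f z')) (v'' : F.stalk (f z'')),
        (⟨f z', v'⟩ : Etale F.stalk) = ⟨f z'', v''⟩ →
          (⟨z', v'⟩ : Etale (F.pullback f).stalk) = ⟨z'', v''⟩ := by
      rintro z' _ rfl v' v'' h
      exact congrArg (Etale.mk _) (F.mk_inj h)
    refine key _ _ (mul_smul _ _ z) _ _ ?_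
    refine (E.mk_actTo (γ * γ') (hf _ z).symm v).trans ((E.actEtale_mul _ _ _).trans ?_)
    refine Eq.trans ?_ (E.mk_actTo γ (hf γ (γ' • z)).symm _).symm
    exact congrArg _ (E.mk_actTo γ' (hf γ' z).symm v).symm
  continuous_act γ := by
    refine (F.continuous_pullback_iff f).2 ⟨?_, ?_⟩
    · exact (continuous_const_smul γ).comp (F.pullback f).continuous_base
    · refine (((E.continuous_act γ).comp
        ((F.continuous_pullback_iff f).1 continuous_id).2).congr ?_)
      intro e
      exact (E.mk_actTo γ (hf γ e.base).symm e.val).symm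

/-- The action of `Γ` on cochains: `(γ φ)(σ) = γ (φ (γ⁻¹ σ))`. -/
def cochainRep [ContinuousConstSMul Γ X] (n : ℕ) : Representation ℂ Γ (F.Cochain n) where
  toFun γ :=
    { toFun := fun φ σ => ⟨fun t => E.actTo γ (smul_inv_smul γ (σ t)) ((φ (γ⁻¹ • σ)).1 t), by
        refine (((E.continuous_act γ).comp (φ (γ⁻¹ • σ)).2).congr ?_)
        intro t
        exact (E.mk_actTo γ (smul_inv_smul γ (σ t)) _).symm⟩
      map_add' := fun φ ψ => funext fun σ => Subtype.ext <| funext fun t =>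
        map_add (E.actTo γ (smul_inv_smul γ (σ t))) _ _
      map_smul' := fun c φ => funext fun σ => Subtype.ext <| funext fun t =>
        map_smul (E.actTo γ (smul_inv_smul γ (σ t))) c _ }
  map_one' := by
    refine LinearMap.ext fun φ => funext fun σ => Subtype.ext <| funext fun t => F.mk_inj ?_
    refine (E.mk_actTo 1 (smul_inv_smul 1 (σ t)) _).trans ((E.actEtale_one _).trans ?_)
    exact F.mk_congr φ (σ := (1 : Γ)⁻¹ • σ) (σ' := σ) (by rw [inv_one, one_smul]) t
  map_mul' γ γ' := by
    refine LinearMap.ext fun φ => funext fun σ => Subtype.ext <| funext fun t => F.mk_inj ?_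
    refine (E.mk_actTo (γ * γ') (smul_inv_smul _ (σ t)) _).trans ((E.actEtale_mul _ _ _).trans ?_)
    refine Eq.trans ?_ (E.mk_actTo γ (smul_inv_smul γ (σ t)) _).symm
    refine congrArg _ (Eq.trans ?_ (E.mk_actTo γ' (smul_inv_smul γ' ((γ⁻¹ • σ) t)) _).symm)
    exact congrArg _ (F.mk_congr φ (σ := (γ * γ')⁻¹ • σ) (σ' := γ'⁻¹ • γ⁻¹ • σ)
      (by rw [mul_inv_rev, mul_smul]) t)

section

variable [ContinuousConstSMul Γ X]

theorem mk_cochainRep {n : ℕ} (γ : Γ) (φ : F.Cochain n) (σ : C(Simplex n, X)) (t : Simplex n) :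
    (⟨σ t, (E.cochainRep n γ φ σ).1 t⟩ : Etale F.stalk) =
      E.actEtale γ ⟨(γ⁻¹ • σ) t, (φ (γ⁻¹ • σ)).1 t⟩ :=
  E.mk_actTo γ (smul_inv_smul γ (σ t)) _

theorem coface_cochainRep {n : ℕ} (i : Fin (n + 2)) (γ : Γ) (φ : F.Cochain n) :
    F.coface i (E.cochainRep n γ φ) = E.cochainRep (n + 1) γ (F.coface i φ) := by
  refine F.cochain_ext fun σ => ?_
  let t : Simplex n := stdSimplex.vertex (S := ℝ) (0 : Fin (n + 1))
  refine ⟨faceMap i t, F.mk_inj ?_⟩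
  rw [F.coface_apply_face, mk_cochainRep, F.coface_apply_face]
  exact E.mk_cochainRep γ φ (σ.comp (faceMap i)) t

theorem δ_cochainRep {n : ℕ} (γ : Γ) (φ : F.Cochain n) :
    F.δ n (E.cochainRep n γ φ) = E.cochainRep (n + 1) γ (F.δ n φ) := by
  simp [δ, LinearMap.sum_apply, coface_cochainRep]

theorem cochainRep_mem_vanishing {A : Set X} (hA : ∀ (γ : Γ), ∀ x ∈ A, γ • x ∈ A) {n : ℕ} (γ : Γ)
    {φ : F.Cochain n} (h : φ ∈ F.vanishing A n) : E.cochainRep n γ φ ∈ F.vanishing A n := by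
  intro σ hσ
  refine Subtype.ext <| funext fun t => F.mk_inj ?_
  rw [mk_cochainRep, h (γ⁻¹ • σ) fun t => hA _ _ (hσ t)]
  refine (E.mk_actTo γ (smul_inv_smul γ (σ t)) 0).symm.trans ?_
  rw [map_zero]
  rfl

theorem cochainRep_mem_relCocycles {A B : Set X} (hA : ∀ (γ : Γ), ∀ x ∈ A, γ • x ∈ A)
    (hB : ∀ (γ : Γ), ∀ x ∈ B, γ • x ∈ B) {n : ℕ} (γ : Γ) {φ : F.Cochain n}
    (h : φ ∈ F.relCocycles B A n) : E.cochainRep n γ φ ∈ F.relCocycles B A n := by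
  refine ⟨E.cochainRep_mem_vanishing hA γ h.1, ?_⟩
  change F.δ n (E.cochainRep n γ φ) ∈ F.vanishing B (n + 1)
  rw [δ_cochainRep]
  exact E.cochainRep_mem_vanishing hB γ h.2

theorem cochainRep_mem_coboundaries {A : Set X} (hA : ∀ (γ : Γ), ∀ x ∈ A, γ • x ∈ A)
    {n : ℕ} (γ : Γ) {φ : F.Cochain n}
    (h : φ ∈ F.coboundaries A n) : E.cochainRep n γ φ ∈ F.coboundaries A n := by
  cases n with
  | zero =>
    rw [show φ = 0 from h, map_zero]
    exact zero_mem _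
  | succ n =>
    obtain ⟨ψ, hψ, rfl⟩ := h
    exact ⟨_, E.cochainRep_mem_vanishing hA γ hψ, E.δ_cochainRep γ ψ⟩

theorem cochainRep_mem_relCoboundaries {A B : Set X} (hA : ∀ (γ : Γ), ∀ x ∈ A, γ • x ∈ A)
    (hB : ∀ (γ : Γ), ∀ x ∈ B, γ • x ∈ B) {n : ℕ} (γ : Γ) {φ : F.Cochain n}
    (h : φ ∈ F.relCoboundaries B A n) : E.cochainRep n γ φ ∈ F.relCoboundaries B A n := by
  obtain ⟨ψ, hψ, η, hη, rfl⟩ := Submodule.mem_sup.1 h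
  rw [map_add]
  exact Submodule.add_mem_sup (E.cochainRep_mem_vanishing hB γ hψ)
    (E.cochainRep_mem_coboundaries hA γ hη)

/-- The action of `Γ` on the cohomology of `X`. -/
def cohomologyRep (n : ℕ) : Representation ℂ Γ (F.Cohomology n) where
  toFun γ := Submodule.mapQ _ _
    ((E.cochainRep n γ).restrict fun _ h =>
      E.cochainRep_mem_relCocycles (by simp) (by simp) γ h)
    fun _ h => E.cochainRep_mem_relCoboundaries (by simp) (by simp) γ h
  map_one' := by
    refine LinearMap.ext fun a => ?_
    obtain ⟨φ, rfl⟩ := Submodule.Quotient.mk_surjective _ a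
    refine congrArg Submodule.Quotient.mk (Subtype.ext ?_)
    exact LinearMap.congr_fun (map_one (E.cochainRep n)) φ.1
  map_mul' γ γ' := by
    refine LinearMap.ext fun a => ?_
    obtain ⟨φ, rfl⟩ := Submodule.Quotient.mk_surjective _ a
    refine congrArg Submodule.Quotient.mk (Subtype.ext ?_)
    exact LinearMap.congr_fun (map_mul (E.cochainRep n) γ γ') φ.1

end

end EquivariantStructure

end Equivariant

end HilbertLocalSystem

/-! ### Torsion of complexes of `Γ`-Hilbert modules -/

section Algebra

open Representation

/-- The space `C(Γ)` of complex class functions on `Γ`. -/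
def ClassFunction (Γ : Type w) [Group Γ] : Submodule ℂ (Γ → ℂ) where
  carrier := {φ | ∀ g h : Γ, φ (h * g * h⁻¹) = φ g}
  zero_mem' _ _ := rfl
  add_mem' ha hb g h := by simp [ha g h, hb g h]
  smul_mem' c a ha g h := by simp [ha g h]

/-- Restriction of class functions to a subgroup. -/
def ClassFunction.res {Γ : Type w} [Group Γ] (Γ' : Subgroup Γ) (φ : ClassFunction Γ) :
    ClassFunction Γ' :=
  ⟨fun g => φ.1 g, fun g h => φ.2 g h⟩

/-- An irreducible finite-dimensional complex representation of `Γ`. -/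
structure Irrep (Γ : Type w) [Group Γ] where
  dim : ℕ
  rep : Representation ℂ Γ (Fin dim → ℂ)
  isIrreducible : rep.IsIrreducible

/-- Isomorphism of irreducible representations. -/
instance Irrep.setoid (Γ : Type w) [Group Γ] : Setoid (Irrep Γ) where
  r π π' := Nonempty (π.rep.Equiv π'.rep)
  iseqv := ⟨fun _ => ⟨.refl _⟩, fun ⟨e⟩ => ⟨e.symm⟩, fun ⟨e⟩ ⟨e'⟩ => ⟨e.trans e'⟩⟩

/-- The set of isomorphism classes of irreducible representations of `Γ`. -/
abbrev IrrepClass (Γ : Type w) [Group Γ] : Type w := Quotient (Irrep.setoid Γ)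

/-- The character `χ_π`. -/
def Irrep.char {Γ : Type w} [Group Γ] (π : Irrep Γ) : ClassFunction Γ :=
  ⟨π.rep.character, fun g h => π.rep.char_conj g h⟩

section LogDet

variable {Γ : Type w} [Group Γ] {V W : Type u}
  [NormedAddCommGroup V] [InnerProductSpace ℂ V] [NormedAddCommGroup W] [InnerProductSpace ℂ W]
  {ρ : Representation ℂ Γ V} {σ : Representation ℂ Γ W}

/-- The `π`-isotypic component `V(π)`, the sum of the images of all equivariant maps `π → V`. -/
def isotypic {V : Type u} [AddCommGroup V] [Module ℂ V] (ρ : Representation ℂ Γ V) (π : Irrep Γ) :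
    Submodule ℂ V :=
  ⨆ T : IntertwiningMap π.rep ρ, LinearMap.range T.toLinearMap

theorem isotypic_le_comap (f : IntertwiningMap ρ σ) (π : Irrep Γ) :
    isotypic ρ π ≤ (isotypic σ π).comap f.toLinearMap := by
  refine iSup_le fun T => ?_
  rintro _ ⟨v, rfl⟩
  exact Submodule.mem_iSup_of_mem (f.comp T) ⟨v, rfl⟩

/-- The map `f(π) : V(π) → W(π)` induced by an equivariant map `f`. -/
def isotypicMap (f : IntertwiningMap ρ σ) (π : Irrep Γ) : isotypic ρ π →ₗ[ℂ] isotypic σ π :=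
  f.toLinearMap.restrict (isotypic_le_comap f π)

variable [FiniteDimensional ℂ V] [FiniteDimensional ℂ W]

/-- The coefficient `[[f]](π) = (2 dim π)⁻¹ log |det (f(π)^* f(π))|`. -/
def logDet (f : IntertwiningMap ρ σ) (π : Irrep Γ) : ℝ :=
  1 / (2 * (π.dim : ℝ)) *
    Real.log ‖LinearMap.det (LinearMap.adjoint (isotypicMap f π) ∘ₗ isotypicMap f π)‖

/-- The class function `∑_π [[f]](π) χ_π`. -/
def logDetClass (f : IntertwiningMap ρ σ) : ClassFunction Γ :=
  ∑ᶠ π : IrrepClass Γ, ((logDet f π.out : ℝ) : ℂ) • π.out.char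

end LogDet

open scoped InnerProductSpace

/-- A finite cochain complex `C⁰ → C¹ → ⋯` of finite-dimensional `Γ`-Hilbert modules. -/
structure HilbertComplex (Γ : Type w) [Group Γ] where
  V : ℕ → Type u
  [normedAddCommGroup : ∀ n, NormedAddCommGroup (V n)]
  [innerProductSpace : ∀ n, InnerProductSpace ℂ (V n)]
  [finiteDimensional : ∀ n, FiniteDimensional ℂ (V n)]
  rep : ∀ n, Representation ℂ Γ (V n)
  inner_rep : ∀ n γ (v w : V n), ⟪rep n γ v, rep n γ w⟫_ℂ = ⟪v, w⟫_ℂ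
  d : ∀ n, V n →ₗ[ℂ] V (n + 1)
  d_d : ∀ n v, d (n + 1) (d n v) = 0
  d_rep : ∀ n γ v, d n (rep n γ v) = rep (n + 1) γ (d n v)
  /-- a bound for the degrees of the non-zero modules -/
  len : ℕ
  subsingleton : ∀ n, len ≤ n → Subsingleton (V n)

attribute [instance] HilbertComplex.normedAddCommGroup HilbertComplex.innerProductSpace
  HilbertComplex.finiteDimensional

namespace HilbertComplex

variable {Γ : Type w} [Group Γ]

/-- Restriction of the group to a subgroup. -/
def res (C : HilbertComplex.{u, w} Γ) (Γ' : Subgroup Γ) : HilbertComplex.{u, w} Γ' where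
  V := C.V
  rep n := (C.rep n).comp Γ'.subtype
  inner_rep n γ := C.inner_rep n γ
  d := C.d
  d_d := C.d_d
  d_rep n γ := C.d_rep n γ
  len := C.len
  subsingleton := C.subsingleton

/-- An equivariant chain contraction: `κ d + d κ = 1`. -/
structure Contraction (C : HilbertComplex.{u, w} Γ) where
  κ : ∀ n, C.V (n + 1) →ₗ[ℂ] C.V n
  κ_rep : ∀ n γ v, κ n (C.rep (n + 1) γ v) = C.rep n γ (κ n v)
  zero : ∀ v : C.V 0, κ 0 (C.d 0 v) = v
  succ : ∀ n (v : C.V (n + 1)), C.d n (κ n v) + κ (n + 1) (C.d (n + 1) v) = v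

/-- The sum of the modules of even degree. -/
abbrev Ev (C : HilbertComplex.{u, w} Γ) : Type u := PiLp 2 fun k : Fin C.len => C.V (2 * k)

/-- The sum of the modules of odd degree. -/
abbrev Odd (C : HilbertComplex.{u, w} Γ) : Type u := PiLp 2 fun k : Fin C.len => C.V (2 * k + 1)

/-- The componentwise representation on a Hilbert sum. -/
def sumRep {ι : Type*} {V : ι → Type u} [∀ i, NormedAddCommGroup (V i)]
    [∀ i, InnerProductSpace ℂ (V i)] (rep : ∀ i, Representation ℂ Γ (V i)) :
    Representation ℂ Γ (PiLp 2 V) where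
  toFun γ :=
    { toFun := fun x => WithLp.toLp 2 fun i => rep i γ (x i)
      map_add' := fun x y => by ext i; simp
      map_smul' := fun c x => by ext i; simp }
  map_one' := by ext x i; simp
  map_mul' γ γ' := by ext x i; simp

/-- The equivariant map `c + κ : C^{ev} → C^{odd}`. -/
def evOdd (C : HilbertComplex.{u, w} Γ) (κ : C.Contraction) :
    IntertwiningMap (sumRep fun k : Fin C.len => C.rep (2 * k))
      (sumRep fun k : Fin C.len => C.rep (2 * k + 1)) where
  toFun x := WithLp.toLp 2 fun k => C.d (2 * k) (x k) +
    if h : (k : ℕ) + 1 < C.len then κ.κ (2 * k + 1) (x ⟨k + 1, h⟩) else 0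
  map_add' x y := by
    ext k
    simp only [PiLp.add_apply, map_add]
    split_ifs <;> abel
  map_smul' c x := by
    ext k
    simp only [PiLp.smul_apply, map_smul, RingHom.id_apply, smul_add]
    split_ifs <;> simp
  isIntertwining' γ := by
    ext x k
    simp only [LinearMap.comp_apply, LinearMap.coe_mk, AddHom.coe_mk, sumRep, MonoidHom.coe_mk,
      OneHom.coe_mk, map_add, C.d_rep]
    congr 1
    split_ifs with h
    · exact κ.κ_rep (2 * k + 1) γ _
    · simp

open Classical in
/-- The torsion `ρ(C) ∈ C(Γ)` of an acyclic complex, that is one with a chain contraction. -/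
def acyclicTorsion (C : HilbertComplex.{u, w} Γ) : ClassFunction Γ :=
  if h : Nonempty C.Contraction then logDetClass (C.evOdd h.some) else 0

/-- An equivariant chain map. -/
structure Hom (C D : HilbertComplex.{u, w} Γ) where
  f : ∀ n, C.V n →ₗ[ℂ] D.V n
  f_rep : ∀ n γ v, f n (C.rep n γ v) = D.rep n γ (f n v)
  comm : ∀ n v, D.d n (f n v) = f (n + 1) (C.d n v)

/-- The module in degree `n` of the shifted complex `D[-1]`, which is `Dⁿ⁻¹`. -/
def Shift (D : HilbertComplex.{u, w} Γ) : ℕ → Type u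
  | 0 => PUnit
  | n + 1 => D.V n

namespace Shift

variable (D : HilbertComplex.{u, w} Γ)

instance : ∀ n, NormedAddCommGroup (D.Shift n)
  | 0 => inferInstanceAs (NormedAddCommGroup PUnit)
  | n + 1 => inferInstanceAs (NormedAddCommGroup (D.V n))

instance : ∀ n, InnerProductSpace ℂ (D.Shift n)
  | 0 => inferInstanceAs (InnerProductSpace ℂ PUnit)
  | n + 1 => inferInstanceAs (InnerProductSpace ℂ (D.V n))

instance : ∀ n, FiniteDimensional ℂ (D.Shift n)
  | 0 => inferInstanceAs (FiniteDimensional ℂ PUnit)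
  | n + 1 => inferInstanceAs (FiniteDimensional ℂ (D.V n))

/-- The representation on the shifted complex. -/
def rep : ∀ n, Representation ℂ Γ (D.Shift n)
  | 0 => Representation.trivial ℂ Γ PUnit.{u + 1}
  | n + 1 => D.rep n

/-- The differential of the shifted complex, without sign. -/
def d : ∀ n, D.Shift n →ₗ[ℂ] D.Shift (n + 1)
  | 0 => 0
  | n + 1 => D.d n

theorem inner_rep (n : ℕ) (γ : Γ) (v w : D.Shift n) :
    ⟪rep D n γ v, rep D n γ w⟫_ℂ = ⟪v, w⟫_ℂ := by
  cases n with
  | zero => rfl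
  | succ n => exact D.inner_rep n γ v w

theorem d_d (n : ℕ) (v : D.Shift n) : d D (n + 1) (d D n v) = 0 := by
  cases n with
  | zero => exact map_zero _
  | succ n => exact D.d_d n v

theorem d_rep (n : ℕ) (γ : Γ) (v : D.Shift n) :
    d D n (rep D n γ v) = rep D (n + 1) γ (d D n v) := by
  cases n with
  | zero => exact (map_zero (D.rep 0 γ)).symm
  | succ n => exact D.d_rep n γ v

theorem subsingleton (n : ℕ) (h : D.len + 1 ≤ n) : Subsingleton (D.Shift n) := by
  cases n with
  | zero => omega
  | succ n => exact D.subsingleton n (by omega)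

end Shift

/-- The chain map viewed as a family of maps `Cⁿ → D[-1]ⁿ⁺¹`. -/
def Hom.shift {C D : HilbertComplex.{u, w} Γ} (f : C.Hom D) (n : ℕ) :
    C.V n →ₗ[ℂ] D.Shift (n + 1) := f.f n

theorem prod_ext {V W : Type u} {x y : WithLp 2 (V × W)} (h₁ : x.fst = y.fst)
    (h₂ : x.snd = y.snd) : x = y :=
  WithLp.ofLp_injective 2 (Prod.ext h₁ h₂)

/-- The cone of a chain map, with modules `Cⁿ ⊕ Dⁿ⁻¹` and differential
`(x, y) ↦ (c x, f x - d y)`. -/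
def cone {C D : HilbertComplex.{u, w} Γ} (f : C.Hom D) : HilbertComplex.{u, w} Γ where
  V n := WithLp 2 (C.V n × D.Shift n)
  rep n :=
    { toFun := fun γ =>
        { toFun := fun x => WithLp.toLp 2 (C.rep n γ x.fst, Shift.rep D n γ x.snd)
          map_add' := fun x y => prod_ext (map_add (C.rep n γ) _ _) (map_add (Shift.rep D n γ) _ _)
          map_smul' := fun c x =>
            prod_ext (map_smul (C.rep n γ) c _) (map_smul (Shift.rep D n γ) c _) }
      map_one' := LinearMap.ext fun x =>
        prod_ext (LinearMap.congr_fun (map_one (C.rep n)) x.fst)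
          (LinearMap.congr_fun (map_one (Shift.rep D n)) x.snd)
      map_mul' := fun γ γ' => LinearMap.ext fun x =>
        prod_ext (LinearMap.congr_fun (map_mul (C.rep n) γ γ') x.fst)
          (LinearMap.congr_fun (map_mul (Shift.rep D n) γ γ') x.snd) }
  inner_rep n γ v w := by
    simp [WithLp.prod_inner_apply, C.inner_rep, Shift.inner_rep]
  d n :=
    { toFun := fun x => WithLp.toLp 2 (C.d n x.fst, f.shift n x.fst - Shift.d D n x.snd)
      map_add' := fun x y => prod_ext (map_add (C.d n) _ _) (by
        change f.shift n (x.fst + y.fst) - Shift.d D n (x.snd + y.snd) =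
          (f.shift n x.fst - Shift.d D n x.snd) + (f.shift n y.fst - Shift.d D n y.snd)
        rw [map_add, map_add, add_sub_add_comm])
      map_smul' := fun c x => prod_ext (map_smul (C.d n) c _) (by
        change f.shift n (c • x.fst) - Shift.d D n (c • x.snd) =
          c • (f.shift n x.fst - Shift.d D n x.snd)
        rw [map_smul, map_smul, smul_sub]) }
  d_d n x := prod_ext (C.d_d n x.fst) (by
    change f.shift (n + 1) (C.d n x.fst) -
      Shift.d D (n + 1) (f.shift n x.fst - Shift.d D n x.snd) = 0
    rw [map_sub, Shift.d_d, sub_zero, sub_eq_zero]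
    exact (f.comm n x.fst).symm)
  d_rep n γ x := prod_ext (C.d_rep n γ x.fst) (by
    change f.shift n (C.rep n γ x.fst) - Shift.d D n (Shift.rep D n γ x.snd) =
      Shift.rep D (n + 1) γ (f.shift n x.fst - Shift.d D n x.snd)
    rw [map_sub, Shift.d_rep]
    exact congrArg (· - _) (f.f_rep n γ x.fst))
  len := max C.len (D.len + 1)
  subsingleton n h := by
    have := C.subsingleton n (le_trans (le_max_left _ _) h)
    have := Shift.subsingleton D n (le_trans (le_max_right _ _) h)
    exact (WithLp.equiv 2 _).subsingleton

/-! #### The cohomology of a complex and the torsion in general -/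

variable (C : HilbertComplex.{u, w} Γ)

/-- The space of coboundaries of degree `n`. -/
def boundaries : ∀ n, Submodule ℂ (C.V n)
  | 0 => ⊥
  | n + 1 => LinearMap.range (C.d n)

theorem rep_mem_ker (n : ℕ) (γ : Γ) (v : C.V n) (h : v ∈ LinearMap.ker (C.d n)) :
    C.rep n γ v ∈ LinearMap.ker (C.d n) := by
  rw [LinearMap.mem_ker] at h ⊢
  rw [C.d_rep, h, map_zero]

theorem rep_mem_boundaries (n : ℕ) (γ : Γ) (v : C.V n) (h : v ∈ C.boundaries n) :
    C.rep n γ v ∈ C.boundaries n := by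
  cases n with
  | zero =>
    rw [show v = 0 from h, map_zero]
    exact zero_mem _
  | succ n =>
    obtain ⟨x, rfl⟩ := h
    exact ⟨C.rep n γ x, C.d_rep n γ x⟩

/-- The cohomology `Hⁿ(C)`. -/
def Cohomology (n : ℕ) : Type u :=
  LinearMap.ker (C.d n) ⧸ (C.boundaries n).submoduleOf (LinearMap.ker (C.d n))

instance (n : ℕ) : AddCommGroup (C.Cohomology n) := inferInstanceAs
  (AddCommGroup (LinearMap.ker (C.d n) ⧸ (C.boundaries n).submoduleOf (LinearMap.ker (C.d n))))

instance (n : ℕ) : Module ℂ (C.Cohomology n) := inferInstanceAs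
  (Module ℂ (LinearMap.ker (C.d n) ⧸ (C.boundaries n).submoduleOf (LinearMap.ker (C.d n))))

instance (n : ℕ) : FiniteDimensional ℂ (C.Cohomology n) := inferInstanceAs (FiniteDimensional ℂ
  (LinearMap.ker (C.d n) ⧸ (C.boundaries n).submoduleOf (LinearMap.ker (C.d n))))

/-- The cohomology class of a cocycle. -/
def cls {n : ℕ} (v : LinearMap.ker (C.d n)) : C.Cohomology n := Submodule.Quotient.mk v

/-- The action of `Γ` on `Hⁿ(C)`. -/
def cohomologyRep (n : ℕ) : Representation ℂ Γ (C.Cohomology n) where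
  toFun γ := Submodule.mapQ _ _ ((C.rep n γ).restrict (C.rep_mem_ker n γ))
    fun v h => C.rep_mem_boundaries n γ v.1 h
  map_one' := by
    refine LinearMap.ext fun a => ?_
    obtain ⟨φ, rfl⟩ := Submodule.Quotient.mk_surjective _ a
    refine congrArg Submodule.Quotient.mk (Subtype.ext ?_)
    exact LinearMap.congr_fun (map_one (C.rep n)) φ.1
  map_mul' γ γ' := by
    refine LinearMap.ext fun a => ?_
    obtain ⟨φ, rfl⟩ := Submodule.Quotient.mk_surjective _ a
    refine congrArg Submodule.Quotient.mk (Subtype.ext ?_)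
    exact LinearMap.congr_fun (map_mul (C.rep n) γ γ') φ.1

end HilbertComplex

/-- A `Γ`-invariant inner product on a `Γ`-module: together with finite-dimensionality this is a
`Γ`-Hilbert module structure. -/
structure InvariantInnerProduct {Γ : Type w} [Group Γ] {V : Type u} [AddCommGroup V] [Module ℂ V]
    (ρ : Representation ℂ Γ V) where
  core : InnerProductSpace.Core ℂ V
  inner_rep : ∀ γ v w, core.inner (ρ γ v) (ρ γ w) = core.inner v w

namespace HilbertComplex

variable {Γ : Type w} [Group Γ] (C : HilbertComplex.{u, w} Γ)
  (h : ∀ n, InvariantInnerProduct (C.cohomologyRep n))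

/-- The complex `H(C)` with zero differential, for a choice of `Γ`-Hilbert module structures on the
cohomology of `C`. -/
def cohomologyComplex : HilbertComplex.{u, w} Γ :=
  letI i₁ : ∀ n, NormedAddCommGroup (C.Cohomology n) := fun n =>
    @InnerProductSpace.Core.toNormedAddCommGroup ℂ _ _ _ _ (h n).core
  letI i₂ : ∀ n, InnerProductSpace ℂ (C.Cohomology n) := fun n =>
    InnerProductSpace.ofCore (h n).core.toCore
  { V := C.Cohomology
    normedAddCommGroup := i₁
    innerProductSpace := i₂
    finiteDimensional := fun n => inferInstance
    rep := C.cohomologyRep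
    inner_rep := fun n γ v w => (h n).inner_rep γ v w
    d := fun _ => 0
    d_d := fun _ _ => rfl
    d_rep := fun n γ _ => (map_zero (C.cohomologyRep (n + 1) γ)).symm
    len := C.len
    subsingleton := fun n hn => by
      have := C.subsingleton n hn
      exact (Submodule.Quotient.mk_surjective _).subsingleton }

/-- An equivariant embedding `i : H(C) → C` inducing the identity in cohomology. -/
structure Embedding extends (C.cohomologyComplex h).Hom C where
  injective : ∀ n, Function.Injective (f n)
  cls_eq : ∀ n (a : C.Cohomology n), ∃ ha : f n a ∈ LinearMap.ker (C.d n), C.cls ⟨f n a, ha⟩ = a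

open Classical in
/-- The torsion `ρ(C) = -t(i)`, where `i : H(C) → C` is an embedding inducing the identity in
cohomology and `t(i)` is the torsion of its cone. -/
def torsion : ClassFunction Γ :=
  if hi : Nonempty (C.Embedding h) then -(cone hi.some.toHom).acyclicTorsion else 0

end HilbertComplex

end Algebra

/-! ### `Γ`-CW-complexes and cellular cochains -/

section Cellular

open CWComplex

/-- The map of pairs `(Δⁿ, ∂Δⁿ) → (Dⁿ, ∂Dⁿ)` of degree `±1`, where `Dⁿ = [-1, 1]ⁿ` is the closed unit
ball of the maximum norm; it sends the part of `Δⁿ` with `0 < t_k < 1 / (n + 1)` for `k = 1, …, n`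
homeomorphically onto the interior of `Dⁿ` and everything else to the boundary. -/
def collapse (n : ℕ) : C(Simplex n, Fin n → ℝ) :=
  ⟨fun t k => 2 * min 1 ((n + 1 : ℝ) * t k.succ) - 1, by
    have : ∀ k : Fin n, Continuous fun t : Simplex n => t k.succ := fun k =>
      (continuous_apply k.succ).comp continuous_subtype_val
    exact continuous_pi fun k =>
      (continuous_const.mul (continuous_const.min (continuous_const.mul (this k)))).sub
        continuous_const⟩

theorem collapse_mem (n : ℕ) (t : Simplex n) : collapse n t ∈ Metric.closedBall 0 1 := by
  rw [mem_closedBall_zero_iff, pi_norm_le_iff_of_nonneg zero_le_one]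
  intro k
  have h0 : 0 ≤ (n + 1 : ℝ) * t k.succ := mul_nonneg (by positivity) (stdSimplex.zero_le t _)
  have h1 : min 1 ((n + 1 : ℝ) * t k.succ) ≤ 1 := min_le_left _ _
  have h2 : 0 ≤ min 1 ((n + 1 : ℝ) * t k.succ) := le_min zero_le_one h0
  change ‖2 * min 1 ((n + 1 : ℝ) * t k.succ) - 1‖ ≤ 1
  rw [Real.norm_eq_abs, abs_le]
  constructor <;> linarith

theorem collapse_mem_sphere (n : ℕ) (t : Simplex (n + 1)) (i : Fin (n + 2)) (h : t i = 0) :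
    collapse (n + 1) t ∈ Metric.sphere 0 1 := by
  rw [mem_sphere_zero_iff_norm]
  refine le_antisymm (mem_closedBall_zero_iff.1 (collapse_mem _ t)) ?_
  obtain ⟨k, hk⟩ : ∃ k, ‖collapse (n + 1) t k‖ = 1 := by
    cases i using Fin.cases with
    | succ k =>
      refine ⟨k, ?_⟩
      change ‖2 * min 1 (((n + 1 : ℕ) + 1 : ℝ) * t k.succ) - 1‖ = 1
      rw [h, mul_zero, min_eq_right zero_le_one]
      norm_num
    | zero =>
      have hs : ∑ k : Fin (n + 1), t k.succ = 1 := by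
        have := stdSimplex.sum_eq_one t
        rwa [Fin.sum_univ_succ, h, zero_add] at this
      obtain ⟨k, -, hk⟩ : ∃ k ∈ (Finset.univ : Finset (Fin (n + 1))),
          (1 : ℝ) / (n + 1) ≤ t k.succ := by
        refine Finset.exists_le_of_sum_le Finset.univ_nonempty ?_
        rw [hs, Finset.sum_const, Finset.card_univ, Fintype.card_fin, nsmul_eq_mul]
        push_cast
        rw [mul_one_div_cancel (by positivity)]
      refine ⟨k, ?_⟩
      change ‖2 * min 1 (((n + 1 : ℕ) + 1 : ℝ) * t k.succ) - 1‖ = 1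
      rw [min_eq_left]
      · norm_num
      · rw [div_le_iff₀ (by positivity)] at hk
        have := stdSimplex.zero_le t k.succ
        push_cast
        nlinarith
  rw [← hk]
  exact norm_le_pi_norm _ k

variable {Z : Type u} [TopologicalSpace Z] [CWComplex (univ : Set Z)]

/-- The characteristic map of a cell as a singular simplex. -/
def cellSimplex {n : ℕ} (e : cell (univ : Set Z) n) : C(Simplex n, Z) :=
  ⟨fun t => map n e (collapse n t), by
    have := (continuousOn n e).comp_continuous (collapse n).continuous (collapse_mem n)
    exact this⟩

/-- The subspace `Z_{n-1}`, the union of the cells of dimension less than `n`. -/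
def skel (Z : Type u) [TopologicalSpace Z] [CWComplex (univ : Set Z)] (n : ℕ) : Set Z :=
  ⋃ (m : ℕ) (_ : m < n) (e : cell (univ : Set Z) m), closedCell m e

theorem cellSimplex_mem {n : ℕ} (e : cell (univ : Set Z) n) (t : Simplex n) :
    cellSimplex e t ∈ skel Z (n + 1) :=
  mem_iUnion.2 ⟨n, mem_iUnion₂.2 ⟨Nat.lt_succ_self n, e, _, collapse_mem n t, rfl⟩⟩

theorem cellSimplex_face_mem {n : ℕ} (e : cell (univ : Set Z) (n + 1)) (i : Fin (n + 2))
    (t : Simplex n) : cellSimplex e (faceMap i t) ∈ skel Z (n + 1) := by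
  obtain ⟨I, hI⟩ := cellFrontier_subset_finite_closedCell (n + 1) e
  have := hI ⟨_, collapse_mem_sphere n (faceMap i t) i (faceMap_apply_self i t), rfl⟩
  simp only [mem_iUnion] at this
  obtain ⟨m, hm, j, -, hj⟩ := this
  exact mem_iUnion.2 ⟨m, mem_iUnion₂.2 ⟨hm, j, hj⟩⟩

/-- A base point of the closed cell `e`. -/
def cellPoint {n : ℕ} (e : cell (univ : Set Z) n) : Z :=
  cellSimplex e (stdSimplex.vertex (S := ℝ) (0 : Fin (n + 1)))

/-- The structure of a `Γ`-CW-complex on the CW-complex `Z` for a discrete group `Γ`: the group permutes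
the `n`-cells, and the characteristic maps fit together to an equivariant map from the
product of the `Γ`-set of `n`-cells with `Dⁿ`. Thus the `n`-cells in the orbit of a cell `e` with
isotropy group `H` form one equivariant cell `Γ/H × Dⁿ`. -/
structure EquivariantCells (Γ : Type w) [Group Γ] (Z : Type u) [TopologicalSpace Z]
    [MulAction Γ Z] [CWComplex (univ : Set Z)] where
  smul : ∀ {n : ℕ}, Γ → cell (univ : Set Z) n → cell (univ : Set Z) n
  one_smul : ∀ {n : ℕ} (e : cell (univ : Set Z) n), smul 1 e = e
  mul_smul : ∀ {n : ℕ} (γ γ' : Γ) (e : cell (univ : Set Z) n),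
    smul (γ * γ') e = smul γ (smul γ' e)
  map_smul : ∀ (n : ℕ) (γ : Γ) (e : cell (univ : Set Z) n),
    ∀ x ∈ Metric.closedBall (0 : Fin n → ℝ) 1, map n (smul γ e) x = γ • map n e x

namespace EquivariantCells

variable {Γ : Type w} [Group Γ] [MulAction Γ Z]

theorem smul_mem_skel (A : EquivariantCells Γ Z) (n : ℕ) (γ : Γ) (z : Z) (h : z ∈ skel Z n) :
    γ • z ∈ skel Z n := by
  simp only [skel, mem_iUnion] at h ⊢
  obtain ⟨m, hm, e, x, hx, rfl⟩ := h
  exact ⟨m, hm, A.smul γ e, x, hx, A.map_smul m γ e x hx⟩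

variable (A : EquivariantCells Γ Z)

/-- Restriction of the group to a subgroup. -/
def res (Γ' : Subgroup Γ) : EquivariantCells Γ' Z where
  smul γ e := A.smul (γ : Γ) e
  one_smul e := A.one_smul e
  mul_smul γ γ' e := A.mul_smul (γ : Γ) (γ' : Γ) e
  map_smul n γ e x hx := A.map_smul n (γ : Γ) e x hx

theorem cellSimplex_smul [ContinuousConstSMul Γ Z] {n : ℕ} (γ : Γ) (e : cell (univ : Set Z) n) :
    cellSimplex (A.smul γ e) = γ • cellSimplex e :=
  ContinuousMap.ext fun t => A.map_smul n γ e _ (collapse_mem n t)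

theorem smul_inv_smul (n : ℕ) (γ : Γ) (e : cell (univ : Set Z) n) :
    A.smul γ (A.smul γ⁻¹ e) = e := by
  rw [← A.mul_smul, mul_inv_cancel, A.one_smul]

theorem smul_cellPoint {n : ℕ} (γ : Γ) (e : cell (univ : Set Z) n) :
    γ • cellPoint e = cellPoint (A.smul γ e) :=
  (A.map_smul n γ e _ (collapse_mem n _)).symm

theorem smul_cellPoint_inv {n : ℕ} (γ : Γ) (e : cell (univ : Set Z) n) :
    γ • cellPoint (A.smul γ⁻¹ e) = cellPoint e := by
  rw [A.smul_cellPoint, A.smul_inv_smul]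

end EquivariantCells

namespace HilbertLocalSystem

variable (F : HilbertLocalSystem.{u, v} Z)

/-- Evaluation of cochains on the characteristic maps of the cells. -/
def evalCells (n : ℕ) :
    F.Cochain n →ₗ[ℂ] ∀ e : cell (univ : Set Z) n, F.stalk (cellPoint e) where
  toFun φ e := (φ (cellSimplex e)).1 _
  map_add' _ _ := rfl
  map_smul' _ _ := rfl

theorem evalCells_eq_zero {n : ℕ} {φ : F.Cochain n}
    (h : φ ∈ F.relCoboundaries (skel Z (n + 1)) (skel Z n) n) : F.evalCells n φ = 0 := by
  obtain ⟨ψ, hψ, η, hη, rfl⟩ := Submodule.mem_sup.1 h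
  have h1 : F.evalCells n ψ = 0 := funext fun e =>
    congrFun (congrArg Subtype.val (hψ (cellSimplex e) (cellSimplex_mem e))) _
  have h2 : F.evalCells n η = 0 := by
    cases n with
    | zero => rw [show η = 0 from hη, map_zero]
    | succ n =>
      obtain ⟨ζ, hζ, rfl⟩ := hη
      have : ∀ e : cell (univ : Set Z) (n + 1), F.δ n ζ (cellSimplex e) = 0 := by
        intro e
        simp only [δ, LinearMap.sum_apply, LinearMap.smul_apply, Cochain.sum_apply,
          Cochain.smul_apply]
        refine Finset.sum_eq_zero fun i _ => ?_
        rw [coface_apply, hζ ((cellSimplex e).comp (faceMap i)) (cellSimplex_face_mem e i),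
          map_zero, smul_zero]
      exact funext fun e => congrFun (congrArg Subtype.val (this e)) _
  rw [map_add, h1, h2, add_zero]

/-- The Hilbert space of cellular `n`-cochains: the orthogonal sum of the stalks over the
`n`-cells. -/
abbrev CellCochain (n : ℕ) : Type (max u v) :=
  PiLp 2 fun e : cell (univ : Set Z) n => F.stalk (cellPoint e)

/-- The map `Hⁿ(Z_n, Z_{n-1}; F) → ⨁_e F_e` given by evaluation on the characteristic maps. -/
def cellEval (n : ℕ) : F.RelCohomology (skel Z (n + 1)) (skel Z n) n →ₗ[ℂ] F.CellCochain n :=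
  Submodule.liftQ _
    ((WithLp.linearEquiv 2 ℂ _).symm.toLinearMap ∘ₗ F.evalCells n ∘ₗ Submodule.subtype _)
    fun φ h => by
      rw [LinearMap.mem_ker]
      exact congrArg (WithLp.toLp 2) (F.evalCells_eq_zero h)

open Classical in
/-- The cellular coboundary: the connecting map
`Hⁿ(Z_n, Z_{n-1}; F) → Hⁿ⁺¹(Z_{n+1}, Z_n; F)`, transported along the isomorphisms `cellEval`. -/
def cellD (n : ℕ) : F.CellCochain n →ₗ[ℂ] F.CellCochain (n + 1) :=
  if h : ∀ m, Function.Bijective (F.cellEval m) then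
    F.cellEval (n + 1) ∘ₗ F.connecting (skel Z (n + 2)) (skel Z (n + 1)) (skel Z n) n ∘ₗ
      (LinearEquiv.ofBijective (F.cellEval n) (h n)).symm.toLinearMap
  else 0

theorem cellD_cellEval (h : ∀ m, Function.Bijective (F.cellEval m)) {n : ℕ} (φ : F.Cochain n)
    (hφ : φ ∈ F.relCocycles (skel Z (n + 1)) (skel Z n) n) :
    F.cellD n (WithLp.toLp 2 (F.evalCells n φ)) = WithLp.toLp 2 (F.evalCells (n + 1) (F.δ n φ)) := by
  have key : (LinearEquiv.ofBijective (F.cellEval n) (h n)).symm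
      (WithLp.toLp 2 (F.evalCells n φ)) = Submodule.Quotient.mk ⟨φ, hφ⟩ := by
    rw [LinearEquiv.symm_apply_eq]
    rfl
  rw [cellD, dif_pos h]
  simp only [LinearMap.comp_apply, LinearEquiv.coe_coe, key]
  rfl

theorem exists_evalCells (h : ∀ m, Function.Bijective (F.cellEval m)) {n : ℕ}
    (c : F.CellCochain n) : ∃ φ ∈ F.relCocycles (skel Z (n + 1)) (skel Z n) n,
      c = WithLp.toLp 2 (F.evalCells n φ) := by
  obtain ⟨a, rfl⟩ := (h n).2 c
  obtain ⟨⟨φ, hφ⟩, rfl⟩ := Submodule.Quotient.mk_surjective _ a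
  exact ⟨φ, hφ, rfl⟩

theorem cellD_cellD (n : ℕ) (c : F.CellCochain n) : F.cellD (n + 1) (F.cellD n c) = 0 := by
  by_cases h : ∀ m, Function.Bijective (F.cellEval m)
  · obtain ⟨φ, hφ, rfl⟩ := F.exists_evalCells h c
    rw [F.cellD_cellEval h φ hφ, F.cellD_cellEval h _ (F.δ_mem_relCocycles hφ), δ_δ, map_zero]
    rfl
  · simp [cellD, h]

namespace EquivariantStructure

variable {Γ : Type w} [Group Γ] [MulAction Γ Z] {F} (E : F.EquivariantStructure Γ)
  (A : EquivariantCells Γ Z)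

theorem mk_cell_congr {n : ℕ} (c : ∀ e : cell (univ : Set Z) n, F.stalk (cellPoint e))
    {e e' : cell (univ : Set Z) n} (h : e = e') :
    (⟨cellPoint e, c e⟩ : Etale F.stalk) = ⟨cellPoint e', c e'⟩ := by
  subst h; rfl

/-- The action of `Γ` on cellular cochains: `(γ c)(e) = γ (c (γ⁻¹ e))`. -/
def cellRep (n : ℕ) : Representation ℂ Γ (F.CellCochain n) where
  toFun γ :=
    { toFun := fun c => WithLp.toLp 2 fun e =>
        E.actTo γ (A.smul_cellPoint_inv γ e) (c (A.smul γ⁻¹ e))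
      map_add' := fun c c' => by ext e; simp
      map_smul' := fun a c => by ext e; simp }
  map_one' := by
    refine LinearMap.ext fun c => PiLp.ext fun e => F.mk_inj ?_
    refine (E.mk_actTo 1 (A.smul_cellPoint_inv 1 e) _).trans ((E.actEtale_one _).trans ?_)
    exact mk_cell_congr c (by rw [inv_one, A.one_smul])
  map_mul' γ γ' := by
    refine LinearMap.ext fun c => PiLp.ext fun e => F.mk_inj ?_
    refine (E.mk_actTo (γ * γ') (A.smul_cellPoint_inv _ e) _).trans
      ((E.actEtale_mul _ _ _).trans ?_)
    refine Eq.trans ?_ (E.mk_actTo γ (A.smul_cellPoint_inv γ e) _).symm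
    refine congrArg _ (Eq.trans ?_ (E.mk_actTo γ' (A.smul_cellPoint_inv γ' (A.smul γ⁻¹ e)) _).symm)
    exact congrArg _ (mk_cell_congr c (by rw [mul_inv_rev, A.mul_smul]))

theorem evalCells_cochainRep [ContinuousConstSMul Γ Z] {n : ℕ} (γ : Γ) (φ : F.Cochain n) :
    WithLp.toLp 2 (F.evalCells n (E.cochainRep n γ φ)) =
      E.cellRep A n γ (WithLp.toLp 2 (F.evalCells n φ)) := by
  refine PiLp.ext fun e => F.mk_inj ?_
  refine (E.mk_cochainRep γ φ (cellSimplex e) _).trans ?_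
  refine Eq.trans ?_ (E.mk_actTo γ (A.smul_cellPoint_inv γ e) _).symm
  exact congrArg _ (F.mk_congr φ (A.cellSimplex_smul γ⁻¹ e).symm _)

theorem cellD_cellRep [ContinuousConstSMul Γ Z] (n : ℕ) (γ : Γ) (c : F.CellCochain n) :
    F.cellD n (E.cellRep A n γ c) = E.cellRep A (n + 1) γ (F.cellD n c) := by
  by_cases h : ∀ m, Function.Bijective (F.cellEval m)
  · obtain ⟨φ, hφ, rfl⟩ := F.exists_evalCells h c
    rw [← evalCells_cochainRep, F.cellD_cellEval h _
      (E.cochainRep_mem_relCocycles (A.smul_mem_skel n) (A.smul_mem_skel (n + 1)) γ hφ),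
      F.cellD_cellEval h φ hφ, ← evalCells_cochainRep, δ_cochainRep]
  · simp [cellD, h]

variable [CWComplex.Finite (univ : Set Z)]

instance cellFintype (n : ℕ) : Fintype (cell (univ : Set Z) n) :=
  @Fintype.ofFinite _ (FiniteType.finite_cell n)

open scoped InnerProductSpace in
theorem inner_cellRep (n : ℕ) (γ : Γ) (c c' : F.CellCochain n) :
    ⟪E.cellRep A n γ c, E.cellRep A n γ c'⟫_ℂ = ⟪c, c'⟫_ℂ := by
  rw [PiLp.inner_apply, PiLp.inner_apply]
  let p : Equiv.Perm (cell (univ : Set Z) n) :=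
    ⟨A.smul γ⁻¹, A.smul γ, fun e => A.smul_inv_smul n γ e, fun e => by
      have := A.smul_inv_smul n γ⁻¹ e
      rwa [inv_inv] at this⟩
  rw [← Equiv.sum_comp p fun e => ⟪c e, c' e⟫_ℂ]
  exact Finset.sum_congr rfl fun e _ =>
    (E.actTo γ (A.smul_cellPoint_inv γ e)).inner_map_map _ _

variable (Z) in
/-- There are only cells of bounded dimension. -/
theorem exists_isEmpty_cell : ∃ N : ℕ, ∀ n, N ≤ n → IsEmpty (cell (univ : Set Z) n) :=
  Filter.eventually_atTop.1 (FiniteDimensional.eventually_isEmpty_cell (C := (univ : Set Z)))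

/-- The cellular cochain complex `C(Z, F)` of a finite `Γ`-CW-complex `Z`, as a complex of
`Γ`-Hilbert modules. -/
def cellularComplex [ContinuousConstSMul Γ Z] : HilbertComplex.{max u v, w} Γ where
  V := F.CellCochain
  rep := E.cellRep A
  inner_rep := E.inner_cellRep A
  d := F.cellD
  d_d := F.cellD_cellD
  d_rep := E.cellD_cellRep A
  len := (exists_isEmpty_cell Z).choose
  subsingleton n hn := by
    have := (exists_isEmpty_cell Z).choose_spec n hn
    exact ⟨fun a b => PiLp.ext fun e => isEmptyElim e⟩

end EquivariantStructure

end HilbertLocalSystem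

end Cellular

/-! ### Reidemeister torsion -/

section Reidemeister

/-- Two continuous maps are `Γ`-homotopic if there is a homotopy between them through
`Γ`-equivariant maps. -/
def EquivariantlyHomotopic (Γ : Type w) {A : Type u} {B : Type v} [TopologicalSpace A]
    [TopologicalSpace B] [SMul Γ A] [SMul Γ B] (f g : C(A, B)) : Prop :=
  ∃ H : f.Homotopy g, ∀ (γ : Γ) (t : unitInterval) (a : A), H (t, γ • a) = γ • H (t, a)

/-- A pair `(Z, f)` representing a simple structure on the `Γ`-space `X`: a finite `Γ`-CW-complex `Z`
and a `Γ`-homotopy equivalence `f : Z → X`. -/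
structure SimpleStructure (Γ : Type w) [Group Γ] (X : Type u) [TopologicalSpace X]
    [MulAction Γ X] where
  Z : Type u
  [topologicalSpace : TopologicalSpace Z]
  [t2Space : T2Space Z]
  [mulAction : MulAction Γ Z]
  [continuousConstSMul : ContinuousConstSMul Γ Z]
  [cwComplex : CWComplex (univ : Set Z)]
  [finite : CWComplex.Finite (univ : Set Z)]
  cells : EquivariantCells Γ Z
  f : C(Z, X)
  f_smul : ∀ (γ : Γ) z, f (γ • z) = γ • f z
  exists_inverse : ∃ g : C(X, Z), (∀ (γ : Γ) x, g (γ • x) = γ • g x) ∧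
    EquivariantlyHomotopic Γ (f.comp g) (ContinuousMap.id X) ∧
    EquivariantlyHomotopic Γ (g.comp f) (ContinuousMap.id Z)

attribute [instance] SimpleStructure.topologicalSpace SimpleStructure.t2Space
  SimpleStructure.mulAction SimpleStructure.continuousConstSMul SimpleStructure.cwComplex
  SimpleStructure.finite

/-- The restricted simple structure, represented by `(res Z, f)`. -/
def SimpleStructure.res {Γ : Type w} [Group Γ] {X : Type u} [TopologicalSpace X]
    [MulAction Γ X] (S : SimpleStructure Γ X) (Γ' : Subgroup Γ) : SimpleStructure Γ' X where
  Z := S.Z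
  continuousConstSMul := ⟨fun γ => continuous_const_smul (γ : Γ)⟩
  cells := S.cells.res Γ'
  f := S.f
  f_smul γ := S.f_smul (γ : Γ)
  exists_inverse := by
    obtain ⟨g, hg, ⟨H, hH⟩, ⟨K, hK⟩⟩ := S.exists_inverse
    exact ⟨g, fun γ => hg (γ : Γ), ⟨H, fun γ => hH (γ : Γ)⟩, ⟨K, fun γ => hK (γ : Γ)⟩⟩

namespace SimpleStructure

variable {Γ : Type w} [Group Γ] {X : Type u} [TopologicalSpace X] [MulAction Γ X]
  (S : SimpleStructure.{u, w} Γ X) {F : HilbertLocalSystem.{u, v} X} (E : F.EquivariantStructure Γ)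

/-- The cellular cochain complex `C(Z, f^*F)`. -/
def cochainComplex : HilbertComplex.{max u v, w} Γ :=
  (E.pullback S.f S.f_smul).cellularComplex S.cells

/-- The condition that `θ` is the canonical map `f^* : Hⁿ(X, F) → Hⁿ(C(Z, f^*F))`, the composition of
the map `f^* : Hⁿ(X, F) → Hⁿ(Z, f^*F)` and the isomorphism of singular and cellular cohomology.
The latter sends the class of a cocycle `ψ` which vanishes on `Z_{n-1}` to the class of the cellular
cocycle given by the class of `ψ` in `Hⁿ(Z_n, Z_{n-1}; f^*F)`. -/
def IsCanonical {n : ℕ} (θ : F.Cohomology n ≃ₗ[ℂ] (S.cochainComplex E).Cohomology n) : Prop :=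
  ∀ (φ : F.relCocycles univ ∅ n) (ψ : (F.pullback S.f).Cochain n),
    ψ ∈ (F.pullback S.f).relCocycles univ (skel S.Z n) n →
    F.pullbackCochain S.f n φ - ψ ∈ (F.pullback S.f).relCoboundaries univ ∅ n →
    ∀ hψ : WithLp.toLp 2 ((F.pullback S.f).evalCells n ψ) ∈
        LinearMap.ker ((S.cochainComplex E).d n),
      θ (Submodule.Quotient.mk φ) = (S.cochainComplex E).cls ⟨_, hψ⟩

theorem pullbackCochain_cochainRep [ContinuousConstSMul Γ X] {n : ℕ} (γ : Γ) (φ : F.Cochain n) :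
    F.pullbackCochain S.f n (E.cochainRep n γ φ) =
      (E.pullback S.f S.f_smul).cochainRep n γ (F.pullbackCochain S.f n φ) := by
  refine funext fun σ => Subtype.ext <| funext fun t => ?_
  refine F.mk_inj (x := S.f (σ t)) ?_
  refine (E.mk_cochainRep γ φ (S.f.comp σ) t).trans ?_
  have key : ∀ (e e' : Etale (F.pullback S.f).stalk), e = e' →
      (⟨S.f e.base, e.val⟩ : Etale F.stalk) = ⟨S.f e'.base, e'.val⟩ := by
    rintro e _ rfl; rfl
  refine Eq.trans ?_ (key _ _ ((E.pullback S.f S.f_smul).mk_cochainRep γ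
    (F.pullbackCochain S.f n φ) σ t)).symm
  refine Eq.trans ?_ (E.mk_actTo γ (S.f_smul γ ((γ⁻¹ • σ) t)).symm _).symm
  refine congrArg _ (F.mk_congr φ (σ := γ⁻¹ • S.f.comp σ) (σ' := S.f.comp (γ⁻¹ • σ)) ?_ t)
  exact ContinuousMap.ext fun t => (S.f_smul γ⁻¹ (σ t)).symm

/-- The canonical map is equivariant, provided it exists and is unique. -/
theorem IsCanonical.equivariant [ContinuousConstSMul Γ X] {n : ℕ}
    {θ : F.Cohomology n ≃ₗ[ℂ] (S.cochainComplex E).Cohomology n} (hθ : S.IsCanonical E θ)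
    (hu : ∀ θ', S.IsCanonical E θ' → θ' = θ) (γ : Γ) (a : F.Cohomology n) :
    θ (E.cohomologyRep n γ a) = (S.cochainComplex E).cohomologyRep n γ (θ a) := by
  have hinv : ∀ {V : Type (max u v)} [AddCommGroup V] [Module ℂ V] (ρ : Representation ℂ Γ V)
      (γ : Γ) (v : V), ρ γ⁻¹ (ρ γ v) = v := fun ρ γ v => by
    rw [← Module.End.mul_apply, ← map_mul, inv_mul_cancel, map_one, Module.End.one_apply]
  let equ : ∀ {V : Type (max u v)} [AddCommGroup V] [Module ℂ V] (_ : Representation ℂ Γ V)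
      (_ : Γ), V ≃ₗ[ℂ] V := fun ρ γ =>
    LinearEquiv.ofLinearMap (ρ γ) (ρ γ⁻¹)
      (LinearMap.ext fun v => by
        have := hinv ρ γ⁻¹ v
        rwa [inv_inv] at this)
      (LinearMap.ext fun v => hinv ρ γ v)
  let θ' := ((equ (E.cohomologyRep n) γ).trans θ).trans
    (equ ((S.cochainComplex E).cohomologyRep n) γ).symm
  have hθ' : S.IsCanonical E θ' := by
    intro φ ψ h1 h2 h3
    have h4 := (E.pullback S.f S.f_smul).cochainRep_mem_relCocycles
      (S.cells.smul_mem_skel n) (B := univ) (by simp) γ h1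
    have h5 := (E.pullback S.f S.f_smul).cochainRep_mem_relCoboundaries
      (A := ∅) (B := univ) (by simp) (by simp) γ h2
    rw [map_sub, ← S.pullbackCochain_cochainRep E] at h5
    have h6 := (E.pullback S.f S.f_smul).evalCells_cochainRep S.cells γ ψ
    have h7 := (S.cochainComplex E).rep_mem_ker n γ _ h3
    have h8 := hθ ⟨E.cochainRep n γ φ.1,
      E.cochainRep_mem_relCocycles (by simp) (by simp) γ φ.2⟩ _ h4 h5 (h6 ▸ h7)
    change (S.cochainComplex E).cohomologyRep n γ⁻¹ (θ (E.cohomologyRep n γ _)) = _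
    refine (congrArg _ (h8.trans ?_)).trans (hinv ((S.cochainComplex E).cohomologyRep n) γ _)
    exact congrArg (S.cochainComplex E).cls (Subtype.ext h6)
  have := LinearEquiv.congr_fun (hu θ' hθ') a
  rw [← this]
  have h9 := hinv ((S.cochainComplex E).cohomologyRep n) γ⁻¹ (θ (E.cohomologyRep n γ a))
  rw [inv_inv] at h9
  exact h9.symm

end SimpleStructure

namespace InvariantInnerProduct

variable {Γ : Type w} [Group Γ] {V W : Type*} [AddCommGroup V] [Module ℂ V] [AddCommGroup W]
  [Module ℂ W] {ρ : Representation ℂ Γ V} {σ : Representation ℂ Γ W}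

/-- The inner product on `W` for which the equivariant isomorphism `θ : V → W` is an isometry. -/
def transport (h : InvariantInnerProduct ρ) (θ : V ≃ₗ[ℂ] W)
    (hθ : ∀ γ v, θ (ρ γ v) = σ γ (θ v)) : InvariantInnerProduct σ where
  core :=
    { inner := fun a b => h.core.inner (θ.symm a) (θ.symm b)
      conj_inner_symm := fun a b => h.core.conj_inner_symm _ _
      re_inner_nonneg := fun a => h.core.re_inner_nonneg _
      add_left := fun a b c => by rw [map_add]; exact h.core.add_left _ _ _
      smul_left := fun a b c => by rw [map_smul]; exact h.core.smul_left _ _ _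
      definite := fun a ha => θ.symm.map_eq_zero_iff.1 (h.core.definite _ ha) }
  inner_rep γ v w := by
    have key : ∀ v, θ.symm (σ γ v) = ρ γ (θ.symm v) := fun v => by
      rw [LinearEquiv.symm_apply_eq, hθ, LinearEquiv.apply_symm_apply]
    change h.core.inner (θ.symm (σ γ v)) (θ.symm (σ γ w)) = _
    rw [key, key, h.inner_rep]
    rfl

end InvariantInnerProduct

variable {Γ : Type w} [Group Γ] {X : Type u} [TopologicalSpace X] [MulAction Γ X]
  [ContinuousConstSMul Γ X]

instance (Γ' : Subgroup Γ) : ContinuousConstSMul Γ' X :=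
  ⟨fun γ => continuous_const_smul (γ : Γ)⟩

/-- The same inner product on `Hⁿ(res X, F) = res Hⁿ(X, F)`. -/
def InvariantInnerProduct.res {F : HilbertLocalSystem.{u, v} X} {E : F.EquivariantStructure Γ}
    {n : ℕ} (h : InvariantInnerProduct (E.cohomologyRep n)) (Γ' : Subgroup Γ) :
    InvariantInnerProduct ((E.res Γ').cohomologyRep n) where
  core := h.core
  inner_rep γ v w := h.inner_rep (γ : Γ) v w

open Classical in
/-- The equivariant Reidemeister torsion `ρ(X, F)` of the `Γ`-space `X` with the simple structure
represented by `S = (Z, f)` and with the `Γ`-Hilbert module structure `h` on `H^*(X, F)`: the torsion of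
the complex `C(Z, f^*F)`, where the cohomology of this complex has the inner product for which
the canonical isomorphism `f^* : H^*(X, F) → H^*(C(Z, f^*F))` is an isometry. -/
def reidemeisterTorsion (S : SimpleStructure.{u, w} Γ X) {F : HilbertLocalSystem.{u, v} X}
    (E : F.EquivariantStructure Γ) (h : ∀ n, InvariantInnerProduct (E.cohomologyRep n)) :
    ClassFunction Γ :=
  if hc : ∀ n, ∃ θ : F.Cohomology n ≃ₗ[ℂ] (S.cochainComplex E).Cohomology n,
      S.IsCanonical E θ ∧ ∀ θ', S.IsCanonical E θ' → θ' = θ then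
    (S.cochainComplex E).torsion fun n =>
      (h n).transport (hc n).choose
        ((hc n).choose_spec.1.equivariant S E (hc n).choose_spec.2)
  else 0

end Reidemeister

end

/-! For an equivariant isomorphism $f$ between unitary modules, $\mathcal
X[[f]](g)=\frac12\operatorname{tr}(g\log(f^*f))$. The eigenspaces $E_a$ of the equivariant
self-adjoint operator $f^*f$ are $\Gamma$-invariant. The logarithm of the determinant of
$f(\pi)^*f(\pi)$ is $\sum_a\dim E_a(\pi)\log a$, and $\chi_{E_a}=\sum_\pi(\dim
E_a(\pi)/\dim\pi)\chi_\pi$. Summing over $\pi$ gives $\mathcal X[[f]]=\frac12\sum_a\log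
a\cdot\chi_{E_a}$ (`logDetClass_apply`). The right-hand side mentions neither irreducible
representations nor the group except through $g$, so it commutes with restriction
(`res_logDetClass`).

The torsion of a complex is defined from a chosen contraction and a chosen embedding of the
cohomology, and the choices for $\Gamma$ and for $\Gamma'$ are unrelated. Hence independence of both
choices is needed. It comes from one deformation principle: along a polynomial family $f_t$,
$t\in\mathbb C$, of isomorphisms the determinant is a polynomial without zeros, hence constant, so
$\mathcal X[[f_t]]$ is constant (`logDetClass_eq_of_polynomial`). Two contractions are joined by an
affine line of contractions (`logDetClass_evOdd_eq`). Two embeddings $i,i'$ are chain homotopic, and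
a shear identifies the cone of $i$ with that of $i+t(i'-i)$, carrying a contraction along
polynomially (`Homotopy.acyclicTorsion_cone_eq`).

After that, the choices made for $\Gamma$ can be used for $\Gamma'$ as well, which gives
`res_torsion`. For spaces, the cellular complex of the restricted data is the restricted complex,
and the canonical map $f^*$ on cohomology does not depend on the group, so the inner products agree
too. -/

noncomputable section

open Set Representation

/-! ### Averaging over a finite group: equivariant lifts and retractions. -/

section Averaging

variable {Γ : Type*} [Group Γ] {V W A : Type*}
  [AddCommGroup V] [Module ℂ V] [AddCommGroup W] [Module ℂ W] [AddCommGroup A] [Module ℂ A]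

/-- The average of a linear map over a finite group, as an equivariant map. -/
def averageIntertwining [Fintype Γ] (ρ : Representation ℂ Γ V) (σ : Representation ℂ Γ W)
    (h : V →ₗ[ℂ] W) : IntertwiningMap ρ σ :=
  { toLinearMap := (Nat.card Γ : ℂ)⁻¹ • ∑ γ : Γ, σ γ ∘ₗ h ∘ₗ ρ γ⁻¹
    isIntertwining' := fun γ => by
      rw [LinearMap.smul_comp, LinearMap.comp_smul]
      congr 1
      refine LinearMap.ext fun v => ?_
      simp only [LinearMap.comp_apply, LinearMap.sum_apply, map_sum]
      rw [← Equiv.sum_comp (Equiv.mulLeft γ)]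
      refine Finset.sum_congr rfl fun δ _ => ?_
      simp only [Equiv.coe_mulLeft, mul_inv_rev, map_mul, Module.End.mul_apply,
        Representation.inv_self_apply] }

theorem averageIntertwining_apply [Fintype Γ] (ρ : Representation ℂ Γ V) (σ : Representation ℂ Γ W)
    (h : V →ₗ[ℂ] W) (v : V) :
    averageIntertwining ρ σ h v = (Nat.card Γ : ℂ)⁻¹ • ∑ γ : Γ, σ γ (h (ρ γ⁻¹ v)) := by
  change ((Nat.card Γ : ℂ)⁻¹ • ∑ γ : Γ, σ γ ∘ₗ h ∘ₗ ρ γ⁻¹ : V →ₗ[ℂ] W) v = _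
  simp [LinearMap.sum_apply]

theorem average_const (a : A) [Fintype Γ] : (Nat.card Γ : ℂ)⁻¹ • ∑ _γ : Γ, a = a := by
  rw [Finset.sum_const, Finset.card_univ, ← Nat.card_eq_fintype_card, ← Nat.cast_smul_eq_nsmul ℂ,
    smul_smul, inv_mul_cancel₀ (Nat.cast_ne_zero.2 Nat.card_pos.ne'), one_smul]

/-- An equivariant map lifts along an equivariant map whose range contains its range. -/
theorem exists_intertwining_lift [Finite Γ] {ρ : Representation ℂ Γ V} {σ : Representation ℂ Γ W}
    {τ : Representation ℂ Γ A} (p : IntertwiningMap ρ σ) (g : IntertwiningMap τ σ)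
    (h : ∀ a, ∃ v, p v = g a) : ∃ l : IntertwiningMap τ ρ, ∀ a, p (l a) = g a := by
  let _ := Fintype.ofFinite Γ
  obtain ⟨l, hl⟩ := Module.projective_lifting_property p.toLinearMap.rangeRestrict
    (g.toLinearMap.codRestrict (LinearMap.range p.toLinearMap) h)
    (LinearMap.surjective_rangeRestrict _)
  have hl' : ∀ a, p (l a) = g a := fun a => congrArg Subtype.val (LinearMap.congr_fun hl a)
  -- A linear lift exists because vector spaces are projective. Averaging keeps it a lift: since `p`
  -- and `g` are equivariant, `p` sends every summand at `a` to `g a`.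
  refine ⟨averageIntertwining τ ρ l, fun a => ?_⟩
  rw [averageIntertwining_apply, map_smul, map_sum]
  simp only [p.isIntertwining, hl', g.isIntertwining, Representation.self_inv_apply]
  exact average_const _

/-- An equivariant injection has an equivariant retraction. -/
theorem exists_intertwining_retraction [Finite Γ] {ρ : Representation ℂ Γ V} {σ : Representation ℂ Γ W}
    (j : IntertwiningMap ρ σ) (hj : Function.Injective j) :
    ∃ r : IntertwiningMap σ ρ, ∀ v, r (j v) = v := by
  let _ := Fintype.ofFinite Γ
  obtain ⟨r, hr⟩ := LinearMap.exists_leftInverse_of_injective j.toLinearMap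
    (LinearMap.ker_eq_bot.2 hj)
  have hr' : ∀ v, r (j v) = v := LinearMap.congr_fun hr
  refine ⟨averageIntertwining σ ρ r, fun v => ?_⟩
  rw [averageIntertwining_apply]
  simp only [← j.isIntertwining, hr', Representation.self_inv_apply]
  exact average_const _

end Averaging

/-! ### Isotypic components and the decomposition of characters. -/

section Isotypic

variable {Γ : Type w} [Group Γ] {V : Type u} {W : Type v} [AddCommGroup V] [Module ℂ V]
  [AddCommGroup W] [Module ℂ W] {ρ : Representation ℂ Γ V} {σ : Representation ℂ Γ W}

/-- Composing a map out of `π` with `f` gives again a map out of `π`. This version of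
`isotypic_le_comap` needs no inner products and lets the two modules live in different universes. -/
theorem map_mem_isotypic (f : IntertwiningMap ρ σ) (π : Irrep Γ) {v : V}
    (hv : v ∈ isotypic ρ π) : f v ∈ isotypic σ π := by
  have : isotypic ρ π ≤ (isotypic σ π).comap f.toLinearMap := by
    refine iSup_le fun T => ?_
    rintro _ ⟨v, rfl⟩
    exact Submodule.mem_iSup_of_mem (f.comp T) ⟨v, rfl⟩
  exact this hv

/-- The inclusion of a subrepresentation. -/
def Subrepresentation.subtype (E : Subrepresentation ρ) :
    IntertwiningMap E.toRepresentation ρ where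
  toLinearMap := E.toSubmodule.subtype
  isIntertwining' _ := rfl

/-- The inclusion of `E` gives one containment. For the other, an equivariant retraction onto `E`
sends $V(\pi)$ into $E(\pi)$ and fixes the vectors of `E`. -/
theorem map_isotypic_toRepresentation [Finite Γ] (E : Subrepresentation ρ) (π : Irrep Γ) :
    (isotypic E.toRepresentation π).map E.toSubmodule.subtype =
      isotypic ρ π ⊓ E.toSubmodule := by
  obtain ⟨r, hr⟩ := exists_intertwining_retraction E.subtype Subtype.val_injective
  refine le_antisymm ?_ ?_
  · rintro _ ⟨v, hv, rfl⟩
    exact ⟨map_mem_isotypic E.subtype π hv, v.2⟩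
  · rintro v ⟨hv, hE⟩
    refine ⟨⟨v, hE⟩, ?_, rfl⟩
    have := map_mem_isotypic r π hv
    rwa [show r v = ⟨v, hE⟩ from hr ⟨v, hE⟩] at this

variable (ρ) in
theorem finrank_isotypic_equiv (e : ρ.Equiv σ) (π : Irrep Γ) :
    Module.finrank ℂ (isotypic ρ π) = Module.finrank ℂ (isotypic σ π) := by
  have h : (isotypic ρ π).map (e.toLinearEquiv : V →ₗ[ℂ] W) = isotypic σ π := by
    refine le_antisymm ?_ fun w hw => ?_
    · rintro _ ⟨v, hv, rfl⟩
      exact map_mem_isotypic e.toIntertwiningMap π hv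
    · exact ⟨e.symm w, map_mem_isotypic e.symm.toIntertwiningMap π hw, e.apply_symm_apply w⟩
  rw [← h]
  exact (LinearEquiv.finrank_map_eq e.toLinearEquiv _).symm

theorem isotypic_eq_top {π : Irrep Γ} (e : π.rep.Equiv ρ) :
    isotypic ρ π = ⊤ :=
  eq_top_iff.2 fun v _ => Submodule.mem_iSup_of_mem e.toIntertwiningMap
    ⟨e.symm v, e.apply_symm_apply v⟩

/-- Schur's lemma: between non-isomorphic irreducible representations every equivariant map is zero.
-/
theorem isotypic_eq_bot [ρ.IsIrreducible] {π : Irrep Γ} (h : IsEmpty (π.rep.Equiv ρ)) :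
    isotypic ρ π = ⊥ := by
  have := π.isIrreducible
  refine (Submodule.eq_bot_iff _).2 fun v hv => ?_
  have hle : isotypic ρ π ≤ ⊥ := iSup_le fun T => by
    rw [Subsingleton.elim T 0]
    simp
  exact hle hv

/-- An irreducible representation on an abstract space, as an element of `Irrep`. -/
theorem exists_irrep [FiniteDimensional ℂ V] [ρ.IsIrreducible] :
    ∃ π : Irrep Γ, Nonempty (π.rep.Equiv ρ) := by
  let b := (Module.finBasis ℂ V).equivFun
  let τ : Representation ℂ Γ (Fin (Module.finrank ℂ V) → ℂ) :=
    { toFun := fun γ => b.toLinearMap ∘ₗ ρ γ ∘ₗ b.symm.toLinearMap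
      map_one' := by ext; simp
      map_mul' := fun γ γ' => by ext; simp }
  let e : τ.Equiv ρ := .mk b.symm fun γ => LinearMap.ext fun v => by simp [τ]
  refine ⟨⟨_, τ, ?_⟩, ⟨e⟩⟩
  have h : ρ.IsIrreducible := inferInstance
  -- Irreducibility says that the lattice of subrepresentations is simple, so it passes along a
  -- lattice isomorphism.
  let o : Subrepresentation τ ≃o Subrepresentation ρ :=
    { toFun := fun S => ⟨S.toSubmodule.comap b.toLinearMap, fun γ v hv => by
        have := S.apply_mem_toSubmodule γ hv
        simpa [τ] using this⟩
      invFun := fun S => ⟨S.toSubmodule.comap b.symm.toLinearMap, fun γ v hv => by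
        have := S.apply_mem_toSubmodule γ hv
        simpa [τ] using this⟩
      left_inv := fun S => by
        ext v
        simp
      right_inv := fun S => by
        ext v
        simp
      map_rel_iff' := by
        intro S T
        constructor
        · intro h v hv
          have hv' : b (b.symm v) ∈ S.toSubmodule := by simpa using! hv
          have : b (b.symm v) ∈ T.toSubmodule := @h (b.symm v) hv'
          simpa using! this
        · intro h v hv
          exact h hv }
  exact o.isSimpleOrder_iff.2 h

section Complement

variable [FiniteDimensional ℂ V] {E E' : Subrepresentation ρ}

/-- The equivariant projections `r` and $1-r$ preserve $V(\pi)$, so it is the direct sum of its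
intersections with `E` and `E'`. -/
theorem finrank_isotypic_add [Finite Γ] (h : IsCompl E.toSubmodule E'.toSubmodule)
    (r : IntertwiningMap ρ E.toRepresentation) (hr : ∀ v : E.toSubmodule, r v = v)
    (hE' : ∀ v, v ∈ E'.toSubmodule ↔ r v = 0) (π : Irrep Γ) :
    Module.finrank ℂ (isotypic ρ π) = Module.finrank ℂ (isotypic E.toRepresentation π) +
      Module.finrank ℂ (isotypic E'.toRepresentation π) := by
  rw [← Submodule.finrank_map_subtype_eq E.toSubmodule (isotypic E.toRepresentation π),
    ← Submodule.finrank_map_subtype_eq E'.toSubmodule (isotypic E'.toRepresentation π),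
    map_isotypic_toRepresentation, map_isotypic_toRepresentation,
    ← Submodule.finrank_sup_add_finrank_inf_eq]
  have h1 : (isotypic ρ π ⊓ E.toSubmodule) ⊓ (isotypic ρ π ⊓ E'.toSubmodule) = ⊥ := by
    rw [← inf_inf_distrib_left, h.inf_eq_bot, inf_bot_eq]
  have h2 : (isotypic ρ π ⊓ E.toSubmodule) ⊔ (isotypic ρ π ⊓ E'.toSubmodule) = isotypic ρ π := by
    refine le_antisymm (sup_le inf_le_left inf_le_left) fun v hv => ?_
    have hrv : (r v : V) ∈ isotypic ρ π :=
      map_mem_isotypic E.subtype π (map_mem_isotypic r π hv)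
    refine Submodule.mem_sup.2 ⟨r v, ⟨hrv, (r v).2⟩, v - r v,
      ⟨sub_mem hv hrv, (hE' _).2 ?_⟩, by abel⟩
    rw [map_sub, hr, sub_self]
  rw [h1, h2, finrank_bot, add_zero]

theorem character_add (h : IsCompl E.toSubmodule E'.toSubmodule) (g : Γ) :
    ρ.character g = E.toRepresentation.character g + E'.toRepresentation.character g := by
  let e := Submodule.prodEquivOfIsCompl _ _ h
  have key : ρ g = e.conj ((E.toRepresentation g).prodMap (E'.toRepresentation g)) := by
    refine LinearMap.ext fun v => ?_
    obtain ⟨x, rfl⟩ := e.surjective v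
    rw [LinearEquiv.conj_apply_apply, LinearEquiv.symm_apply_apply]
    simp [e, Subrepresentation.toRepresentation]
  rw [character, key, LinearMap.trace_conj', LinearMap.trace_prodMap']
  rfl

end Complement

theorem exists_complement [Finite Γ] (E : Subrepresentation ρ) :
    ∃ (E' : Subrepresentation ρ) (r : IntertwiningMap ρ E.toRepresentation),
      IsCompl E.toSubmodule E'.toSubmodule ∧ (∀ v : E.toSubmodule, r v = v) ∧
        ∀ v, v ∈ E'.toSubmodule ↔ r v = 0 := by
  obtain ⟨r, hr⟩ := exists_intertwining_retraction E.subtype Subtype.val_injective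
  exact ⟨r.ker, r, LinearMap.isCompl_of_proj (f := r.toLinearMap) hr, hr, fun v => Iff.rfl⟩

/-- An irreducible representation is non-zero by definition: its lattice of subrepresentations has
two distinct elements. This justifies dividing by `dim`. -/
theorem Irrep.dim_pos (π : Irrep Γ) : 0 < π.dim := by
  by_contra h
  have h0 : π.dim = 0 := by omega
  have : IsEmpty (Fin π.dim) := by rw [h0]; infer_instance
  have hn := π.isIrreducible.toNontrivial
  obtain ⟨S, T, hST⟩ := hn
  exact hST (SetLike.ext fun v => by
    rw [Subsingleton.elim v 0]
    exact ⟨fun _ => T.toSubmodule.zero_mem, fun _ => S.toSubmodule.zero_mem⟩)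

/-- Only the class of `ρ` itself contributes; its isotypic component is everything, so its
coefficient is 1. This is the base case of the decomposition. -/
theorem exists_character_eq_sum_of_isIrreducible [FiniteDimensional ℂ V] [ρ.IsIrreducible] :
    ∃ s : Finset (IrrepClass Γ), (∀ c ∉ s, isotypic ρ c.out = ⊥) ∧
      ∀ g, ρ.character g = ∑ c ∈ s,
        ((Module.finrank ℂ (isotypic ρ c.out) : ℂ) / c.out.dim) * c.out.rep.character g := by
  obtain ⟨π, ⟨e⟩⟩ := exists_irrep (ρ := ρ)
  let c : IrrepClass Γ := Quotient.mk _ π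
  obtain ⟨e'⟩ : Nonempty (c.out.rep.Equiv π.rep) := Quotient.mk_out π
  refine ⟨{c}, fun c' hc' => isotypic_eq_bot ⟨fun e'' => hc' ?_⟩, fun g => ?_⟩
  · rw [Finset.mem_singleton, ← Quotient.out_eq c']
    exact Quotient.sound ⟨e''.trans e.symm⟩
  · have e1 := e'.trans e
    have hd : Module.finrank ℂ V = c.out.dim := by
      rw [← e1.toLinearEquiv.finrank_eq, Module.finrank_fin_fun]
    rw [Finset.sum_singleton, isotypic_eq_top e1, finrank_top, hd,
      div_self (Nat.cast_ne_zero.2 c.out.dim_pos.ne'), one_mul, char_iso e1]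

end Isotypic

/-- The character of a representation is the sum of the irreducible characters, weighted by the
dimensions of the isotypic components. -/
theorem exists_character_eq_sum {Γ : Type w} [Group Γ] [Finite Γ] {V : Type u} [AddCommGroup V]
    [Module ℂ V] [FiniteDimensional ℂ V] (ρ : Representation ℂ Γ V) :
    ∃ s : Finset (IrrepClass Γ), (∀ c ∉ s, isotypic ρ c.out = ⊥) ∧
      ∀ g, ρ.character g = ∑ c ∈ s,
        ((Module.finrank ℂ (isotypic ρ c.out) : ℂ) / c.out.dim) * c.out.rep.character g := by
  classical
  induction hn : Module.finrank ℂ V using Nat.strong_induction_on generalizing V with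
  | _ n ih =>
  subst hn
  cases subsingleton_or_nontrivial V with
  | inl hV =>
    refine ⟨∅, fun c _ => Subsingleton.elim _ _, fun g => ?_⟩
    rw [Finset.sum_empty, character, Subsingleton.elim (ρ g) 0, map_zero]
  | inr hV =>
  -- If some subrepresentation is proper and non-zero, it and its equivariant complement have
  -- smaller dimension, and both characters and isotypic dimensions add up.
  by_cases hi : ∀ E : Subrepresentation ρ, E.toSubmodule = ⊥ ∨ E.toSubmodule = ⊤
  · have : Nontrivial (Subrepresentation ρ) :=
      ⟨⊥, ⊤, fun h => bot_ne_top (congrArg Subrepresentation.toSubmodule h :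
        (⊥ : Submodule ℂ V) = ⊤)⟩
    have : ρ.IsIrreducible :=
      { eq_bot_or_eq_top := fun E => (hi E).imp
          (fun h => Subrepresentation.toSubmodule_injective h)
          (fun h => Subrepresentation.toSubmodule_injective h) }
    exact exists_character_eq_sum_of_isIrreducible
  · push Not at hi
    obtain ⟨E, hb, ht⟩ := hi
    obtain ⟨E', r, hc, hr, hE'⟩ := exists_complement E
    have hadd := Submodule.finrank_add_eq_of_isCompl hc
    have h1 := Submodule.finrank_lt ht
    have h2 : 0 < Module.finrank ℂ E.toSubmodule :=
      Nat.pos_of_ne_zero fun h => hb (Submodule.finrank_eq_zero.1 h)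
    obtain ⟨s, hs, hs'⟩ := ih _ h1 E.toRepresentation rfl
    obtain ⟨t, ht, ht'⟩ := ih _ (by omega) E'.toRepresentation rfl
    refine ⟨s ∪ t, fun c hc' => ?_, fun g => ?_⟩
    · rw [Finset.notMem_union] at hc'
      rw [← Submodule.finrank_eq_zero (R := ℂ), finrank_isotypic_add hc r hr hE', hs c hc'.1,
        ht c hc'.2, finrank_bot, finrank_bot]
    -- Both sums are extended to `s ∪ t`; the terms added have a zero isotypic component.
    · rw [character_add hc, hs', ht',
        Finset.sum_subset (Finset.subset_union_left (s₁ := s) (s₂ := t)) fun c _ hc' => by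
          rw [hs c hc', finrank_bot, Nat.cast_zero, zero_div, zero_mul],
        Finset.sum_subset (Finset.subset_union_right (s₁ := s) (s₂ := t)) fun c _ hc' => by
          rw [ht c hc', finrank_bot, Nat.cast_zero, zero_div, zero_mul],
        ← Finset.sum_add_distrib]
      refine Finset.sum_congr rfl fun c _ => ?_
      rw [finrank_isotypic_add hc r hr hE']
      push_cast
      ring

/-- Any finite set of classes outside which the isotypic components vanish can be used, since the
sum equals the one over all classes. This allows one index set for all eigenspaces of an operator at
once. -/
theorem character_eq_sum {Γ : Type w} [Group Γ] [Finite Γ] {V : Type u} [AddCommGroup V]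
    [Module ℂ V] [FiniteDimensional ℂ V] (ρ : Representation ℂ Γ V) {t : Finset (IrrepClass Γ)}
    (ht : ∀ c ∉ t, isotypic ρ c.out = ⊥) (g : Γ) :
    ρ.character g = ∑ c ∈ t,
      ((Module.finrank ℂ (isotypic ρ c.out) : ℂ) / c.out.dim) * c.out.rep.character g := by
  obtain ⟨s, hs, hsum⟩ := exists_character_eq_sum ρ
  have key : ∀ u : Finset (IrrepClass Γ), (∀ c ∉ u, isotypic ρ c.out = ⊥) →
      ∑ c ∈ u, ((Module.finrank ℂ (isotypic ρ c.out) : ℂ) / c.out.dim) *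
        c.out.rep.character g = ∑ᶠ c : IrrepClass Γ,
      ((Module.finrank ℂ (isotypic ρ c.out) : ℂ) / c.out.dim) * c.out.rep.character g := by
    refine fun u hu => (finsum_eq_sum_of_support_subset _ fun c hc => ?_).symm
    by_contra hcu
    refine hc ?_
    change _ * _ = _
    rw [hu c hcu, finrank_bot, Nat.cast_zero, zero_div, zero_mul]
  rw [hsum, key s hs, key t ht]

theorem injective_isotypicMap {Γ : Type w} [Group Γ] {V W : Type u} [NormedAddCommGroup V]
    [InnerProductSpace ℂ V] [NormedAddCommGroup W] [InnerProductSpace ℂ W]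
    {ρ : Representation ℂ Γ V} {σ : Representation ℂ Γ W} {f : IntertwiningMap ρ σ}
    (hf : Function.Injective f) (π : Irrep Γ) : Function.Injective (isotypicMap f π) :=
  fun _ _ h => Subtype.ext (hf (congrArg Subtype.val h))

/-! ### The trace formula for $\mathcal X[[f]]$ and its restriction to subgroups. -/

section LogDetFormula

open scoped InnerProductSpace

variable {Γ : Type w} [Group Γ] {V W : Type u}
  [NormedAddCommGroup V] [InnerProductSpace ℂ V] [NormedAddCommGroup W] [InnerProductSpace ℂ W]
  [FiniteDimensional ℂ V] [FiniteDimensional ℂ W]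
  {ρ : Representation ℂ Γ V} {σ : Representation ℂ Γ W}

theorem isSymmetric_adjoint_comp (f : V →ₗ[ℂ] W) : (LinearMap.adjoint f ∘ₗ f).IsSymmetric :=
  fun v w => by
    simp only [LinearMap.comp_apply, LinearMap.adjoint_inner_left, LinearMap.adjoint_inner_right]

/-- If $f^*fv=0$ then $\|fv\|^2=\langle f^*fv,v\rangle=0$. -/
theorem injective_adjoint_comp {f : V →ₗ[ℂ] W} (hf : Function.Injective f) :
    Function.Injective (LinearMap.adjoint f ∘ₗ f) := by
  refine (injective_iff_map_eq_zero _).2 fun v hv => ?_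
  have h0 : ⟪f v, f v⟫_ℂ = 0 := by
    rw [← LinearMap.adjoint_inner_left, ← LinearMap.comp_apply, hv, inner_zero_left]
  exact hf ((inner_self_eq_zero.1 h0).trans (map_zero f).symm)

/-- The operator `f^* f` as an equivariant map. -/
def gram (hρ : ∀ γ v w, ⟪ρ γ v, ρ γ w⟫_ℂ = ⟪v, w⟫_ℂ) (hσ : ∀ γ v w, ⟪σ γ v, σ γ w⟫_ℂ = ⟪v, w⟫_ℂ)
    (f : IntertwiningMap ρ σ) : IntertwiningMap ρ ρ where
  toLinearMap := LinearMap.adjoint f.toLinearMap ∘ₗ f.toLinearMap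
  isIntertwining' γ := by
    refine LinearMap.ext fun v => ext_inner_right ℂ fun w => ?_
    simp only [LinearMap.comp_apply]
    -- Writing `w` as $\gamma\gamma^{-1}w$ lets unitarity of both actions cancel $\gamma$ on the two
    -- sides.
    rw [LinearMap.adjoint_inner_left, ← ρ.self_inv_apply γ w, hρ, LinearMap.adjoint_inner_left]
    simp only [IntertwiningMap.toLinearMap_apply, f.isIntertwining, hσ]

/-- The eigenspaces of an equivariant map are subrepresentations. -/
def eigenSubrep (T : IntertwiningMap ρ ρ) (a : ℂ) : Subrepresentation ρ where
  toSubmodule := Module.End.eigenspace T.toLinearMap a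
  apply_mem_toSubmodule γ v hv := by
    rw [Module.End.mem_eigenspace_iff] at hv ⊢
    rw [IntertwiningMap.toLinearMap_apply, T.isIntertwining, ← T.toLinearMap_apply, hv, map_smul]

variable (hρ : ∀ γ v w, ⟪ρ γ v, ρ γ w⟫_ℂ = ⟪v, w⟫_ℂ)
  (hσ : ∀ γ v w, ⟪σ γ v, σ γ w⟫_ℂ = ⟪v, w⟫_ℂ)

/-- The operator $f^*f$ is equivariant and hence preserves $V(\pi)$. There it has the same inner
products with elements of $V(\pi)$ as $f(\pi)^*f(\pi)$. -/
theorem adjoint_isotypicMap_comp_apply (f : IntertwiningMap ρ σ) (π : Irrep Γ)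
    (v : isotypic ρ π) :
    (((LinearMap.adjoint (isotypicMap f π) ∘ₗ isotypicMap f π) v : isotypic ρ π) : V) =
      gram hρ hσ f v := by
  have h := map_mem_isotypic (gram hρ hσ f) π v.2
  refine congrArg Subtype.val (?_ : _ = (⟨_, h⟩ : isotypic ρ π))
  refine ext_inner_right ℂ fun w => ?_
  rw [LinearMap.comp_apply, LinearMap.adjoint_inner_left]
  exact (LinearMap.adjoint_inner_left f.toLinearMap (w : V) (f v)).symm

/-- Seen inside $V$, both spaces are $V(\pi)\cap E_a$, where $E_a$ is the eigenspace of $f^*f$. -/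
theorem finrank_eigenspace_isotypic [Finite Γ] (f : IntertwiningMap ρ σ) (π : Irrep Γ) (a : ℂ) :
    Module.finrank ℂ (Module.End.eigenspace
        (LinearMap.adjoint (isotypicMap f π) ∘ₗ isotypicMap f π) a) =
      Module.finrank ℂ (isotypic (eigenSubrep (gram hρ hσ f) a).toRepresentation π) := by
  refine ((Submodule.finrank_map_subtype_eq (isotypic ρ π) _).symm.trans ?_).trans
    (Submodule.finrank_map_subtype_eq (eigenSubrep (gram hρ hσ f) a).toSubmodule _)
  rw [map_isotypic_toRepresentation]
  refine congrArg (fun S : Submodule ℂ V => Module.finrank ℂ S) (Submodule.ext fun v => ?_)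
  constructor
  · rintro ⟨v, hv, rfl⟩
    refine ⟨v.2, Module.End.mem_eigenspace_iff.2 ?_⟩
    exact (adjoint_isotypicMap_comp_apply hρ hσ f π v).symm.trans
      (congrArg Subtype.val (Module.End.mem_eigenspace_iff.1 hv))
  · rintro ⟨hv, ha⟩
    refine ⟨⟨v, hv⟩, Module.End.mem_eigenspace_iff.2 (Subtype.ext ?_), rfl⟩
    exact (adjoint_isotypicMap_comp_apply hρ hσ f π ⟨v, hv⟩).trans
      (Module.End.mem_eigenspace_iff.1 ha)

/-- The logarithm of the determinant of a symmetric injective operator. -/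
theorem LinearMap.IsSymmetric.log_norm_det_eq_sum {S : V →ₗ[ℂ] V} (hS : S.IsSymmetric)
    (hi : Function.Injective S) {Λ : Finset ℝ}
    (hΛ : ∀ a : ℝ, Module.End.HasEigenvalue S (a : ℂ) → a ∈ Λ) :
    Real.log ‖LinearMap.det S‖ =
      ∑ a ∈ Λ, (Module.finrank ℂ (Module.End.eigenspace S (a : ℂ)) : ℝ) * Real.log |a| := by
  have hne : ∀ i, hS.eigenvalues rfl i ≠ 0 := fun i h0 => by
    have h := hS.hasEigenvalue_eigenvalues rfl i
    obtain ⟨v, hv⟩ := h.exists_hasEigenvector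
    refine hv.2 (hi ?_)
    rw [hv.apply_eq_smul, h0]
    simp
  rw [hS.det_eq_prod_eigenvalues rfl, norm_prod, Real.log_prod fun i _ => by
    simpa using hne i]
  -- The eigenvalues, listed with multiplicity, are grouped by their value. A number in `Λ` that is
  -- not an eigenvalue has an empty group, so `Λ` may be larger than the spectrum.
  rw [← Finset.sum_fiberwise_of_maps_to (g := hS.eigenvalues rfl) (t := Λ) fun i _ =>
    hΛ _ (hS.hasEigenvalue_eigenvalues rfl i)]
  refine Finset.sum_congr rfl fun a _ => ?_
  rw [← hS.card_filter_eigenvalues_eq rfl]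
  rw [Finset.sum_congr rfl (g := fun _ => Real.log |a|), Finset.sum_const, nsmul_eq_mul]
  · congr 3
    ext i
    simp
  · intro i hi
    rw [(Finset.mem_filter.1 hi).2]
    simp

theorem exists_finset_hasEigenvalue (S : V →ₗ[ℂ] V) :
    ∃ Λ : Finset ℝ, ∀ a : ℝ, Module.End.HasEigenvalue S (a : ℂ) → a ∈ Λ := by
  have h := (Module.End.finite_hasEigenvalue S).preimage
    (f := ((↑) : ℝ → ℂ)) Complex.ofReal_injective.injOn
  exact ⟨h.toFinset, fun a ha => h.mem_toFinset.2 ha⟩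

/-- The class function `𝒳[[f]]` is half of the trace of `g log (f^* f)`. -/
theorem logDetClass_apply [Finite Γ] (f : IntertwiningMap ρ σ) (hf : Function.Injective f)
    {Λ : Finset ℝ} (hΛ : ∀ a : ℝ, Module.End.HasEigenvalue (gram hρ hσ f).toLinearMap (a : ℂ) →
      a ∈ Λ) (g : Γ) :
    (logDetClass f).1 g = ∑ a ∈ Λ, ((Real.log |a| / 2 : ℝ) : ℂ) *
      (eigenSubrep (gram hρ hσ f) (a : ℂ)).toRepresentation.character g := by
  -- The classes occurring in all of $V$ serve as a common finite index set: a class missing in $V$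
  -- is missing in every eigenspace (`hbot`).
  obtain ⟨s, hs, -⟩ := exists_character_eq_sum ρ
  have hlog : ∀ π : Irrep Γ, logDet f π = ∑ a ∈ Λ, 1 / (2 * (π.dim : ℝ)) *
      ((Module.finrank ℂ (isotypic (eigenSubrep (gram hρ hσ f) a).toRepresentation π) : ℝ) *
        Real.log |a|) := by
    intro π
    -- An eigenvalue of $f(\pi)^*f(\pi)$ is one of $f^*f$, so the same `Λ` works for every `π`.
    rw [logDet, (isSymmetric_adjoint_comp _).log_norm_det_eq_sum
      (injective_adjoint_comp (injective_isotypicMap hf π)) (Λ := Λ) fun a ha => ?_,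
      Finset.mul_sum]
    · simp only [finrank_eigenspace_isotypic hρ hσ]
    · refine hΛ a ?_
      obtain ⟨v, hv⟩ := ha.exists_hasEigenvector
      refine Module.End.hasEigenvalue_of_hasEigenvector (x := (v : V)) ⟨?_, ?_⟩
      · rw [Module.End.mem_eigenspace_iff]
        exact (adjoint_isotypicMap_comp_apply hρ hσ f π v).symm.trans
          (congrArg Subtype.val hv.apply_eq_smul)
      · exact fun h => hv.2 (Subtype.ext h)
  have hbot : ∀ a : ℂ, ∀ c ∉ s,
      isotypic (eigenSubrep (gram hρ hσ f) a).toRepresentation c.out = ⊥ := by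
    intro a c hc
    refine Submodule.map_injective_of_injective (Submodule.subtype_injective _) ?_
    rw [map_isotypic_toRepresentation, hs c hc, bot_inf_eq, Submodule.map_bot]
  have hsum : logDetClass f = ∑ c ∈ s, ((logDet f c.out : ℝ) : ℂ) • c.out.char := by
    refine finsum_eq_sum_of_support_subset _ fun c hc => ?_
    by_contra hcs
    refine hc ?_
    change _ • _ = _
    rw [hlog, Finset.sum_eq_zero fun a _ => by rw [hbot a c hcs, finrank_bot]; simp]
    simp
  rw [hsum]
  have hval : ∀ (F : IrrepClass Γ → ClassFunction Γ), (∑ c ∈ s, F c).1 g = ∑ c ∈ s, (F c).1 g := by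
    intro F
    rw [Submodule.coe_sum, Finset.sum_apply]
  rw [hval]
  simp_rw [character_eq_sum _ (hbot _), Finset.mul_sum]
  -- Exchanging the sums over eigenvalues and over classes reduces the claim to one class `c` and
  -- one eigenvalue `a`, where the factor $1/\dim\pi$ of `logDet` is the one in the multiplicity
  -- $\dim E_a(\pi)/\dim\pi$.
  rw [Finset.sum_comm]
  refine Finset.sum_congr rfl fun c _ => ?_
  change ((logDet f c.out : ℝ) : ℂ) * c.out.rep.character g = _
  rw [hlog, Complex.ofReal_sum, Finset.sum_mul]
  refine Finset.sum_congr rfl fun a _ => ?_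
  have := Nat.cast_ne_zero (R := ℂ).2 c.out.dim_pos.ne'
  push_cast
  field_simp

/-- The class function `𝒳[[f]]` is compatible with restriction to a subgroup. -/
theorem res_logDetClass [Finite Γ] (Γ' : Subgroup Γ)
    (hρ : ∀ γ v w, ⟪ρ γ v, ρ γ w⟫_ℂ = ⟪v, w⟫_ℂ) (hσ : ∀ γ v w, ⟪σ γ v, σ γ w⟫_ℂ = ⟪v, w⟫_ℂ)
    {ρ' : Representation ℂ Γ' V}
    {σ' : Representation ℂ Γ' W} (hρ' : ∀ γ : Γ', ρ' γ = ρ γ) (hσ' : ∀ γ : Γ', σ' γ = σ γ)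
    (f : IntertwiningMap ρ σ) (f' : IntertwiningMap ρ' σ') (hff : f'.toLinearMap = f.toLinearMap)
    (hf : Function.Injective f) : ClassFunction.res Γ' (logDetClass f) = logDetClass f' := by
  obtain ⟨Λ, hΛ⟩ := exists_finset_hasEigenvalue (gram hρ hσ f).toLinearMap
  obtain rfl : ρ' = ρ.comp Γ'.subtype := MonoidHom.ext hρ'
  obtain rfl : σ' = σ.comp Γ'.subtype := MonoidHom.ext hσ'
  obtain rfl : f' = ⟨f.toLinearMap, fun γ => f.isIntertwining' γ⟩ := IntertwiningMap.ext hff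
  refine Subtype.ext (funext fun g => ?_)
  -- The operator $f^*f$, the set `Λ` and the trace of `g` on each eigenspace are the same for both
  -- groups, so the two formulas agree term by term.
  refine (logDetClass_apply hρ hσ f hf hΛ g).trans ?_
  exact (logDetClass_apply (ρ := ρ.comp Γ'.subtype) (σ := σ.comp Γ'.subtype)
    (fun γ => hρ (γ : Γ)) (fun γ => hσ (γ : Γ))
    ⟨f.toLinearMap, fun γ => f.isIntertwining' γ⟩ hf hΛ g).symm

end LogDetFormula

/-! ### Polynomial families of isomorphisms and the constancy of their torsion. -/

section PolynomialCurves

variable {V W : Type*} [AddCommGroup V] [Module ℂ V] [AddCommGroup W] [Module ℂ W]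

variable (V) in
/-- The space of polynomial curves in a complex vector space. -/
def polynomialCurves : Submodule ℂ (ℂ → V) :=
  Submodule.span ℂ (range fun p : ℕ × V => fun t : ℂ => t ^ p.1 • p.2)

theorem const_mem_polynomialCurves (a : V) : (fun _ => a) ∈ polynomialCurves V :=
  Submodule.subset_span ⟨(0, a), by simp⟩

theorem map_mem_polynomialCurves (L : V →ₗ[ℂ] W) {c : ℂ → V} (hc : c ∈ polynomialCurves V) :
    (fun t => L (c t)) ∈ polynomialCurves W := by
  have : polynomialCurves V ≤ (polynomialCurves W).comap (L.compLeft ℂ) := by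
    refine Submodule.span_le.2 ?_
    rintro _ ⟨⟨n, a⟩, rfl⟩
    exact Submodule.subset_span ⟨(n, L a), funext fun t => by simp⟩
  exact this hc

theorem smul_mem_polynomialCurves {c : ℂ → V} (hc : c ∈ polynomialCurves V) :
    (fun t => t • c t) ∈ polynomialCurves V := by
  let M : (ℂ → V) →ₗ[ℂ] (ℂ → V) :=
    { toFun := fun c t => t • c t
      map_add' := fun c c' => funext fun t => smul_add _ _ _
      map_smul' := fun a c => funext fun t => smul_comm _ _ _ }
  have : polynomialCurves V ≤ (polynomialCurves V).comap M := by
    refine Submodule.span_le.2 ?_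
    rintro _ ⟨⟨n, a⟩, rfl⟩
    exact Submodule.subset_span ⟨(n + 1, a), funext fun t => by
      simp [M, pow_succ', mul_smul]⟩
  exact this hc

theorem exists_polynomial_of_mem_polynomialCurves {c : ℂ → ℂ} (hc : c ∈ polynomialCurves ℂ) :
    ∃ p : Polynomial ℂ, ∀ t, c t = p.eval t := by
  induction hc using Submodule.span_induction with
  | mem c h =>
    obtain ⟨⟨n, a⟩, rfl⟩ := h
    exact ⟨Polynomial.X ^ n * Polynomial.C a, fun t => by simp [-Polynomial.X_pow_mul_C]⟩
  | zero => exact ⟨0, fun t => by simp⟩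
  | add c c' _ _ h h' =>
    obtain ⟨p, hp⟩ := h
    obtain ⟨p', hp'⟩ := h'
    exact ⟨p + p', fun t => by simp [hp, hp']⟩
  | smul a c _ h =>
    obtain ⟨p, hp⟩ := h
    exact ⟨Polynomial.C a * p, fun t => by simp [hp]⟩

/-- By the fundamental theorem of algebra a polynomial without zeros is constant. This is why
deformations run over all of $\mathbb C$ and not over a real interval. -/
theorem eval_eq_eval_of_ne_zero {p : Polynomial ℂ} (hp : ∀ t, p.eval t ≠ 0) (s t : ℂ) :
    p.eval s = p.eval t := by
  have h : p.degree ≤ 0 := by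
    by_contra h
    obtain ⟨z, hz⟩ := Complex.exists_root (not_le.1 h)
    exact hp z hz
  rw [Polynomial.eq_C_of_degree_le_zero h]
  simp

end PolynomialCurves

theorem piLp_mem_polynomialCurves {ι : Type*} [Fintype ι] {V : ι → Type*}
    [∀ i, NormedAddCommGroup (V i)] [∀ i, InnerProductSpace ℂ (V i)] {x : ℂ → PiLp 2 V}
    (hx : ∀ i, (fun t => x t i) ∈ polynomialCurves (V i)) : x ∈ polynomialCurves (PiLp 2 V) := by
  classical
  let L : ∀ i, V i →ₗ[ℂ] PiLp 2 V := fun i =>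
    (WithLp.linearEquiv 2 ℂ (∀ i, V i)).symm.toLinearMap ∘ₗ LinearMap.single ℂ V i
  have : x = ∑ i, fun t => L i (x t i) := by
    funext t
    rw [Finset.sum_apply]
    refine (WithLp.linearEquiv 2 ℂ (∀ i, V i)).injective ?_
    simp only [L, map_sum, LinearMap.comp_apply, LinearEquiv.coe_coe, LinearEquiv.apply_symm_apply,
      LinearMap.single_apply]
    exact (Finset.univ_sum_single _).symm
  rw [this]
  exact Submodule.sum_mem _ fun i _ => map_mem_polynomialCurves (L i) (hx i)

theorem withLpProd_mem_polynomialCurves {V W : Type*} [NormedAddCommGroup V]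
    [InnerProductSpace ℂ V] [NormedAddCommGroup W] [InnerProductSpace ℂ W]
    {x : ℂ → WithLp 2 (V × W)} (h₁ : (fun t => (x t).fst) ∈ polynomialCurves V)
    (h₂ : (fun t => (x t).snd) ∈ polynomialCurves W) :
    x ∈ polynomialCurves (WithLp 2 (V × W)) := by
  let e := (WithLp.linearEquiv 2 ℂ (V × W)).symm.toLinearMap
  have : x = (fun t => (e ∘ₗ LinearMap.inl ℂ V W) (x t).fst) +
      fun t => (e ∘ₗ LinearMap.inr ℂ V W) (x t).snd := by
    funext t
    refine (WithLp.linearEquiv 2 ℂ (V × W)).injective ?_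
    simp only [e, Pi.add_apply, map_add, LinearMap.comp_apply, LinearEquiv.coe_coe,
      LinearEquiv.apply_symm_apply, LinearMap.inl_apply, LinearMap.inr_apply]
    ext <;> simp
  rw [this]
  exact add_mem (map_mem_polynomialCurves _ h₁) (map_mem_polynomialCurves _ h₂)

section Deformation

open scoped InnerProductSpace

variable {Γ : Type w} [Group Γ] {V W : Type u}
  [NormedAddCommGroup V] [InnerProductSpace ℂ V] [NormedAddCommGroup W] [InnerProductSpace ℂ W]
  [FiniteDimensional ℂ V] [FiniteDimensional ℂ W]

/-- The determinant of `f^* f` does not change along a polynomial family of isomorphisms. -/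
theorem norm_det_adjoint_comp_eq {f : ℂ → V →ₗ[ℂ] W} (hf : ∀ t, Function.Injective (f t))
    (hd : Module.finrank ℂ V = Module.finrank ℂ W)
    (hp : ∀ v, (fun t => f t v) ∈ polynomialCurves W) (s t : ℂ) :
    ‖LinearMap.det (LinearMap.adjoint (f s) ∘ₗ f s)‖ =
      ‖LinearMap.det (LinearMap.adjoint (f t) ∘ₗ f t)‖ := by
  let b := stdOrthonormalBasis ℂ V
  let b' := (stdOrthonormalBasis ℂ W).reindex (finCongr hd.symm)
  let M := fun t => LinearMap.toMatrix b.toBasis b'.toBasis (f t)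
  -- The determinant of $f_t^*f_t$ need not be polynomial in $t$, because the adjoint conjugates. In
  -- orthonormal bases it is $|\det M_t|^2$, and $\det M_t$ is polynomial.
  have hM : ∀ t, LinearMap.det (LinearMap.adjoint (f t) ∘ₗ f t) =
      star (M t).det * (M t).det := by
    intro t
    rw [← LinearMap.det_toMatrix b.toBasis, LinearMap.toMatrix_comp b.toBasis b'.toBasis b.toBasis,
      Matrix.det_mul, LinearMap.toMatrix_adjoint, Matrix.det_conjTranspose]
  have hne : ∀ t, (M t).det ≠ 0 := by
    intro t h0
    have h1 := hM t
    rw [h0, mul_zero] at h1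
    exact (LinearMap.bot_lt_ker_of_det_eq_zero h1).ne'
      (LinearMap.ker_eq_bot.2 (injective_adjoint_comp (hf t)))
  have hpoly : ∀ i j, ∃ p : Polynomial ℂ, ∀ t, M t i j = p.eval t := fun i j =>
    exists_polynomial_of_mem_polynomialCurves <| by
      have := map_mem_polynomialCurves (b'.toBasis.coord i) (hp (b j))
      refine (congrArg (· ∈ polynomialCurves ℂ) (funext fun t => ?_)).mp this
      simp [M, LinearMap.toMatrix_apply]
  choose p hp using hpoly
  have hdet : ∀ t, (M t).det = (Matrix.det (Matrix.of p)).eval t := by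
    intro t
    rw [← Polynomial.coe_evalRingHom, RingHom.map_det]
    congr 1
    ext i j
    exact hp i j t
  have key : (M s).det = (M t).det := by
    rw [hdet, hdet]
    exact eval_eq_eval_of_ne_zero (fun t => hdet t ▸ hne t) s t
  rw [hM, hM, key]

/-- The class function `𝒳[[f]]` does not change along a polynomial family of isomorphisms. -/
theorem logDetClass_eq_of_polynomial {ρ : Representation ℂ Γ V} {σ : Representation ℂ Γ W}
    {f : ℂ → IntertwiningMap ρ σ} (hf : ∀ t, Function.Bijective (f t))
    (hp : ∀ v, (fun t => f t v) ∈ polynomialCurves W) (s t : ℂ) :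
    logDetClass (f s) = logDetClass (f t) := by
  unfold logDetClass
  refine finsum_congr fun c => ?_
  have hd := finrank_isotypic_equiv ρ ((f 0).ofBijective (hf 0)) c.out
  -- A linear retraction onto the isotypic component turns a polynomial curve of `W` lying in the
  -- component into a polynomial curve of the component.
  obtain ⟨r, hr⟩ := LinearMap.exists_leftInverse_of_injective (isotypic σ c.out).subtype
    (Submodule.ker_subtype _)
  have hconst := norm_det_adjoint_comp_eq (f := fun t => isotypicMap (f t) c.out)
    (fun t => injective_isotypicMap (hf t).1 c.out) hd (fun v => ?_) s t
  · rw [logDet, logDet, hconst]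
  · refine (congrArg (· ∈ polynomialCurves _) (funext fun t => ?_)).mp
      (map_mem_polynomialCurves r (hp v))
    exact LinearMap.congr_fun hr (isotypicMap (f t) c.out v)

end Deformation

/-! ### Acyclic complexes: bijectivity of $c+\kappa$ and independence of the contraction. -/

namespace HilbertComplex

variable {Γ : Type w} [Group Γ] {C D : HilbertComplex.{u, w} Γ}

section EvOdd

theorem evOdd_apply (κ : C.Contraction) (x : C.Ev) (k : Fin C.len) :
    C.evOdd κ x k = C.d (2 * k) (x k) +
      if h : (k : ℕ) + 1 < C.len then κ.κ (2 * k + 1) (x ⟨k + 1, h⟩) else 0 := rfl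

/-- Descending induction on the degree. Let $x$ be in the kernel, with all components above $x_k$
zero. Component $k$ of the equation gives $dx_k=0$. Component $k-1$ is $dx_{k-1}+\kappa x_k=0$, so
$d\kappa x_k=0$ after applying $d$. Then $x_k=d\kappa x_k+\kappa dx_k=0$. No relation $\kappa^2=0$
is required. -/
theorem injective_evOdd (κ : C.Contraction) : Function.Injective (C.evOdd κ) := by
  refine (injective_iff_map_eq_zero _).2 fun x hx => ?_
  have h : ∀ k : Fin C.len, C.d (2 * k) (x k) +
      (if h : (k : ℕ) + 1 < C.len then κ.κ (2 * k + 1) (x ⟨k + 1, h⟩) else 0) = 0 := fun k =>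
    (evOdd_apply κ x k).symm.trans (by rw [hx]; rfl)
  -- The index `j` counts the components from the top that are already known to vanish.
  have key : ∀ j : ℕ, ∀ k : Fin C.len, C.len - j ≤ (k : ℕ) → x k = 0 := by
    intro j
    induction j with
    | zero => exact fun k hk => absurd k.2 (by omega)
    | succ j ih =>
      intro k hk
      have hd : C.d (2 * k) (x k) = 0 := by
        have h1 := h k
        split_ifs at h1 with h2
        · rwa [ih ⟨k + 1, h2⟩ (by simp only; omega), map_zero, add_zero] at h1
        · rwa [add_zero] at h1
      obtain ⟨k, hk'⟩ := k
      cases k with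
      | zero =>
        have := κ.zero (x ⟨0, hk'⟩)
        rw [← this]
        exact (congrArg (κ.κ 0) hd).trans (map_zero _)
      | succ m =>
        have h1 := h ⟨m, by omega⟩
        rw [dif_pos hk'] at h1
        have h2 := congrArg (C.d (2 * m + 1)) h1
        rw [map_add, C.d_d, zero_add, map_zero] at h2
        refine (κ.succ (2 * m + 1) (x ⟨m + 1, hk'⟩)).symm.trans ?_
        refine (congrArg₂ (· + ·) h2 ((congrArg (κ.κ (2 * m + 1 + 1)) hd).trans
          (map_zero _))).trans (add_zero _)
  ext k
  rw [key C.len k (by omega)]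
  rfl

/-- A contraction makes the complex exact, so this is rank-nullity. -/
theorem finrank_eq_add_finrank_range (κ : C.Contraction) (n : ℕ) :
    Module.finrank ℂ (C.V (n + 1)) = Module.finrank ℂ (LinearMap.range (C.d (n + 1))) +
      Module.finrank ℂ (LinearMap.range (C.d n)) := by
  have h : LinearMap.ker (C.d (n + 1)) = LinearMap.range (C.d n) := by
    refine le_antisymm ?_ ?_
    · intro v hv
      refine ⟨κ.κ n v, ?_⟩
      have := κ.succ n v
      rwa [LinearMap.mem_ker.1 hv, map_zero, add_zero] at this
    · rintro _ ⟨v, rfl⟩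
      exact C.d_d n v
  rw [← h, LinearMap.finrank_range_add_finrank_ker]

theorem finrank_zero_eq_finrank_range (κ : C.Contraction) :
    Module.finrank ℂ (C.V 0) = Module.finrank ℂ (LinearMap.range (C.d 0)) := by
  refine (LinearMap.finrank_range_of_inj fun v w h => ?_).symm
  rw [← κ.zero v, h, κ.zero]

/-- The Euler characteristic of an exact complex vanishes: the partial alternating sum through
degree $2L$ is the rank of the next differential, which is zero beyond the length. -/
theorem finrank_ev_eq_finrank_odd (κ : C.Contraction) :
    Module.finrank ℂ C.Ev = Module.finrank ℂ C.Odd := by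
  have h : ∀ L : ℕ, ∑ k ∈ Finset.range (L + 1), Module.finrank ℂ (C.V (2 * k)) =
      ∑ k ∈ Finset.range L, Module.finrank ℂ (C.V (2 * k + 1)) +
        Module.finrank ℂ (LinearMap.range (C.d (2 * L))) := by
    intro L
    induction L with
    | zero => simpa using! finrank_zero_eq_finrank_range κ
    | succ L ih =>
      rw [Finset.sum_range_succ, ih, Finset.sum_range_succ, finrank_eq_add_finrank_range κ (2 * L),
        show Module.finrank ℂ (C.V (2 * (L + 1))) = _ from
          finrank_eq_add_finrank_range κ (2 * L + 1)]
      rw [show 2 * (L + 1) = 2 * L + 1 + 1 from rfl]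
      ring
  -- The partial sum has one more even term than `Ev` has summands; it is in degree `2 * C.len`,
  -- where the module is zero.
  have hs := C.subsingleton (2 * C.len) (by omega)
  have h0 : Module.finrank ℂ (C.V (2 * C.len)) = 0 := Module.finrank_zero_of_subsingleton
  have h1 := h C.len
  have h2 := LinearMap.finrank_range_le (C.d (2 * C.len))
  rw [Finset.sum_range_succ, h0] at h1
  rw [(WithLp.linearEquiv 2 ℂ (∀ k : Fin C.len, C.V (2 * k))).finrank_eq,
    (WithLp.linearEquiv 2 ℂ (∀ k : Fin C.len, C.V (2 * k + 1))).finrank_eq,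
    Module.finrank_pi_fintype, Module.finrank_pi_fintype,
    Fin.sum_univ_eq_sum_range fun k => Module.finrank ℂ (C.V (2 * k)),
    Fin.sum_univ_eq_sum_range fun k => Module.finrank ℂ (C.V (2 * k + 1))]
  omega

theorem bijective_evOdd (κ : C.Contraction) : Function.Bijective (C.evOdd κ) :=
  ⟨injective_evOdd κ, (LinearMap.injective_iff_surjective_of_finrank_eq_finrank
    (f := (C.evOdd κ).toLinearMap) (finrank_ev_eq_finrank_odd κ)).1 (injective_evOdd κ)⟩

end EvOdd

section ContractionIndependence

/-- The affine family of contractions through two contractions. -/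
def Contraction.line (κ κ' : C.Contraction) (t : ℂ) : C.Contraction where
  κ n := κ.κ n + t • (κ'.κ n - κ.κ n)
  κ_rep n γ v := by
    simp only [LinearMap.add_apply, LinearMap.smul_apply, LinearMap.sub_apply, κ.κ_rep, κ'.κ_rep,
      map_add, map_smul, map_sub]
  zero v := by
    simp only [LinearMap.add_apply, LinearMap.smul_apply, LinearMap.sub_apply, κ.zero, κ'.zero,
      sub_self, smul_zero, add_zero]
  succ n v := by
    simp only [LinearMap.add_apply, LinearMap.smul_apply, LinearMap.sub_apply, map_add, map_smul,
      map_sub]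
    -- The difference of two contractions anticommutes with the differential, so multiples of it can
    -- be added freely.
    have h : C.d n (κ'.κ n v) - C.d n (κ.κ n v) + (κ'.κ (n + 1) (C.d (n + 1) v) -
        κ.κ (n + 1) (C.d (n + 1) v)) = 0 := by
      rw [sub_add_sub_comm, κ'.succ, κ.succ, sub_self]
    rw [add_add_add_comm, κ.succ, ← smul_add, h, smul_zero, add_zero]

/-- Every point of the affine line from `κ` to `κ'` is a contraction, so $c+\kappa_t$ stays
bijective and the deformation principle applies. -/
theorem logDetClass_evOdd_eq (κ κ' : C.Contraction) :
    logDetClass (C.evOdd κ) = logDetClass (C.evOdd κ') := by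
  have h := logDetClass_eq_of_polynomial (f := fun t => C.evOdd (κ.line κ' t))
    (fun t => bijective_evOdd _) (fun x => piLp_mem_polynomialCurves fun k => ?_) 0 1
  · have h0 : κ.line κ' 0 = κ := by
      cases κ
      simp [Contraction.line]
    have h1 : κ.line κ' 1 = κ' := by
      cases κ'
      simp [Contraction.line]
    simpa only [h0, h1] using h
  · simp only [evOdd_apply]
    refine add_mem (const_mem_polynomialCurves _) ?_
    split_ifs with hk
    · exact add_mem (const_mem_polynomialCurves _)
        (smul_mem_polynomialCurves (const_mem_polynomialCurves _))
    · exact const_mem_polynomialCurves _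

/-- Frees the torsion from the contraction picked in its definition. -/
theorem acyclicTorsion_eq (κ : C.Contraction) : C.acyclicTorsion = logDetClass (C.evOdd κ) := by
  have h : Nonempty C.Contraction := ⟨κ⟩
  rw [acyclicTorsion, dif_pos h]
  exact logDetClass_evOdd_eq _ _

end ContractionIndependence

section Deformation

/-- The complex with the same modules and another differential. -/
def withD (K : HilbertComplex.{u, w} Γ) (d : ∀ n, K.V n →ₗ[ℂ] K.V (n + 1))
    (hd : ∀ n v, d (n + 1) (d n v) = 0)
    (hr : ∀ n γ v, d n (K.rep n γ v) = K.rep (n + 1) γ (d n v)) : HilbertComplex.{u, w} Γ where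
  V := K.V
  rep := K.rep
  inner_rep := K.inner_rep
  d := d
  d_d := hd
  d_rep := hr
  len := K.len
  subsingleton := K.subsingleton

/-- The torsion does not change along a polynomial family of differentials and contractions. -/
theorem acyclicTorsion_withD_eq (K : HilbertComplex.{u, w} Γ)
    {d : ℂ → ∀ n, K.V n →ₗ[ℂ] K.V (n + 1)} (hd : ∀ t n v, d t (n + 1) (d t n v) = 0)
    (hr : ∀ t n γ v, d t n (K.rep n γ v) = K.rep (n + 1) γ (d t n v))
    (κ : ∀ t, (K.withD (d t) (hd t) (hr t)).Contraction)
    (hp : ∀ n v, (fun t => d t n v) ∈ polynomialCurves (K.V (n + 1)))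
    (hκ : ∀ n v, (fun t => ((κ t).κ n v : K.V n)) ∈ polynomialCurves (K.V n)) (s t : ℂ) :
    (K.withD (d s) (hd s) (hr s)).acyclicTorsion =
      (K.withD (d t) (hd t) (hr t)).acyclicTorsion := by
  -- Only differentials and contractions vary with `t`, so all maps $c_t+\kappa_t$ have the same
  -- source and target and form a polynomial family.
  let F : ℂ → IntertwiningMap (sumRep fun k : Fin K.len => K.rep (2 * k))
      (sumRep fun k : Fin K.len => K.rep (2 * k + 1)) := fun t =>
    (K.withD (d t) (hd t) (hr t)).evOdd (κ t)
  have hF : ∀ x, (fun t => F t x) ∈ polynomialCurves K.Odd := by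
    intro x
    refine piLp_mem_polynomialCurves fun k => ?_
    by_cases hk : (k : ℕ) + 1 < K.len
    · refine (congrArg (· ∈ polynomialCurves _) (funext fun t => ?_)).mp
        (add_mem (hp (2 * k) (x k)) (hκ (2 * k + 1) (x ⟨k + 1, hk⟩)))
      exact ((evOdd_apply (κ t) x k).trans (congrArg (_ + ·) (dif_pos hk))).symm
    · refine (congrArg (· ∈ polynomialCurves _) (funext fun t => ?_)).mp (hp (2 * k) (x k))
      exact ((evOdd_apply (κ t) x k).trans ((congrArg (_ + ·) (dif_neg hk)).trans
        (add_zero _))).symm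
  have h := logDetClass_eq_of_polynomial (f := F) (fun t => bijective_evOdd (κ t)) hF s t
  exact (acyclicTorsion_eq (κ s)).trans (h.trans (acyclicTorsion_eq (κ t)).symm)

end Deformation

/-! ### Homotopy invariance of the torsion of a cone. -/

section Homotopy

/-- A chain homotopy between two chain maps, with values in the shifted complex. -/
structure Homotopy (f f' : C.Hom D) where
  h : ∀ n, C.V n →ₗ[ℂ] D.Shift n
  h_rep : ∀ n γ v, h n (C.rep n γ v) = Shift.rep D n γ (h n v)
  comm : ∀ n v, Shift.d D n (h n v) + (h (n + 1) (C.d n v) : D.Shift (n + 1)) =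
    f'.shift n v - f.shift n v

variable {f f' : C.Hom D}

/-- The affine family of chain maps through two chain maps. -/
def Hom.line (f f' : C.Hom D) (t : ℂ) : C.Hom D where
  f n := f.f n + t • (f'.f n - f.f n)
  f_rep n γ v := by
    simp only [LinearMap.add_apply, LinearMap.smul_apply, LinearMap.sub_apply, f.f_rep, f'.f_rep,
      map_add, map_smul, map_sub]
  comm n v := by
    simp only [LinearMap.add_apply, LinearMap.smul_apply, LinearMap.sub_apply, f.comm, f'.comm,
      map_add, map_smul, map_sub]

/-- The isomorphism of cones `(x, y) ↦ (x, y + t h x)` given by a chain homotopy. -/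
def Homotopy.shear (H : Homotopy f f') (t : ℂ) (n : ℕ) :
    (cone f).V n →ₗ[ℂ] (cone f).V n where
  toFun x := WithLp.toLp 2 (x.fst, x.snd + t • H.h n x.fst)
  map_add' x y := prod_ext rfl (by
    change x.snd + y.snd + t • H.h n (x.fst + y.fst) =
      x.snd + t • H.h n x.fst + (y.snd + t • H.h n y.fst)
    rw [map_add, smul_add, add_add_add_comm])
  map_smul' a x := prod_ext rfl (by
    change a • x.snd + t • H.h n (a • x.fst) = a • (x.snd + t • H.h n x.fst)
    rw [map_smul, smul_add, smul_comm])

theorem Homotopy.shear_shear_neg (H : Homotopy f f') (t : ℂ) (n : ℕ) (x : (cone f).V n) :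
    H.shear t n (H.shear (-t) n x) = x :=
  prod_ext rfl (by
    change x.snd + -t • H.h n x.fst + t • H.h n x.fst = x.snd
    rw [neg_smul, neg_add_cancel_right])

theorem Homotopy.shear_rep (H : Homotopy f f') (t : ℂ) (n : ℕ) (γ : Γ) (x : (cone f).V n) :
    H.shear t n ((cone f).rep n γ x) = (cone f).rep n γ (H.shear t n x) :=
  prod_ext rfl (by
    change Shift.rep D n γ x.snd + t • H.h n (C.rep n γ x.fst) =
      Shift.rep D n γ (x.snd + t • H.h n x.fst)
    rw [map_add, map_smul, H.h_rep])

/-- Since $f_t-f=t(f'-f)=t(dh+hd)$ and the cone carries $-d$ on its second summand, the term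
$-t\,dh$ from the shear cancels and $t\,hd$ remains. Hence the shear is a chain map from the cone of
$f$ to that of $f_t$; the two cones have the same modules. -/
theorem Homotopy.d_shear (H : Homotopy f f') (t : ℂ) (n : ℕ) (x : (cone f).V n) :
    (cone (f.line f' t)).d n (H.shear t n x) = H.shear t (n + 1) ((cone f).d n x) :=
  prod_ext rfl (by
    change (f.shift n x.fst + t • (f'.shift n x.fst - f.shift n x.fst)) -
      Shift.d D n (x.snd + t • H.h n x.fst) =
        (f.shift n x.fst - Shift.d D n x.snd) + t • H.h (n + 1) (C.d n x.fst)
    rw [← H.comm, map_add, map_smul, smul_add]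
    abel)

theorem Homotopy.d_shear' (H : Homotopy f f') (t : ℂ) (n : ℕ) (x : (cone f).V n) :
    (cone f).d n (H.shear (-t) n x) = H.shear (-t) (n + 1) ((cone (f.line f' t)).d n x) := by
  have h := H.d_shear t n (H.shear (-t) n x)
  rw [H.shear_shear_neg] at h
  refine Eq.trans ?_ (congrArg (H.shear (-t) (n + 1)) h).symm
  have := H.shear_shear_neg (-t) (n + 1) ((cone f).d n (H.shear (-t) n x))
  rw [neg_neg] at this
  exact this.symm

/-- The contraction of the cone transported along a chain homotopy. -/
def Homotopy.contraction (H : Homotopy f f') (κ : (cone f).Contraction) (t : ℂ) :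
    (cone (f.line f' t)).Contraction where
  κ n := H.shear t n ∘ₗ κ.κ n ∘ₗ H.shear (-t) (n + 1)
  κ_rep n γ v := by
    refine (congrArg (fun y => H.shear t n (κ.κ n y)) (H.shear_rep (-t) (n + 1) γ v)).trans ?_
    refine (congrArg (H.shear t n) (κ.κ_rep n γ _)).trans ?_
    exact H.shear_rep t n γ _
  zero v := by
    refine (congrArg (fun y => H.shear t 0 (κ.κ 0 y)) (H.d_shear' t 0 v).symm).trans ?_
    exact (congrArg (H.shear t 0) (κ.zero _)).trans (H.shear_shear_neg t 0 v)
  succ n v := by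
    refine (congrArg₂ (fun y z => y + H.shear t (n + 1) (κ.κ (n + 1) z)) (H.d_shear t n _)
      (H.d_shear' t (n + 1) v).symm).trans ?_
    refine (map_add (H.shear t (n + 1)) _ _).symm.trans ?_
    exact (congrArg (H.shear t (n + 1)) (κ.succ n _)).trans (H.shear_shear_neg t (n + 1) v)

/-- The shear is affine in its parameter: it equals $1+t(S_1-1)$, with $S_1$ the shear at $t=1$. -/
theorem Homotopy.shear_mem_polynomialCurves (H : Homotopy f f') (n : ℕ) {c : ℂ → (cone f).V n}
    (hc : c ∈ polynomialCurves ((cone f).V n)) :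
    (fun t => H.shear t n (c t)) ∈ polynomialCurves ((cone f).V n) := by
  have h := map_mem_polynomialCurves (H.shear 1 n - LinearMap.id) hc
  refine (congrArg (· ∈ polynomialCurves _) (funext fun t => ?_)).mp
    (add_mem hc (smul_mem_polynomialCurves h))
  refine prod_ext ?_ ?_
  · change (c t).fst + t • ((c t).fst - (c t).fst) = (c t).fst
    rw [sub_self, smul_zero, add_zero]
  · change (c t).snd + t • ((c t).snd + (1 : ℂ) • H.h n (c t).fst - (c t).snd) =
      (c t).snd + t • H.h n (c t).fst
    rw [one_smul, add_sub_cancel_left]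

theorem Homotopy.shear_neg_mem_polynomialCurves (H : Homotopy f f') (n : ℕ) (x : (cone f).V n) :
    (fun t => H.shear (-t) n x) ∈ polynomialCurves ((cone f).V n) := by
  refine (congrArg (· ∈ polynomialCurves _) (funext fun t => ?_)).mp
    (sub_mem (const_mem_polynomialCurves x)
      (smul_mem_polynomialCurves (const_mem_polynomialCurves (H.shear 1 n x - x))))
  refine prod_ext ?_ ?_
  · change x.fst - t • (x.fst - x.fst) = x.fst
    rw [sub_self, smul_zero, sub_zero]
  · change x.snd - t • (x.snd + (1 : ℂ) • H.h n x.fst - x.snd) = x.snd + -t • H.h n x.fst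
    rw [one_smul, add_sub_cancel_left, neg_smul, sub_eq_add_neg]

/-- The torsion of the cone of a chain map depends on its homotopy class only. -/
theorem Homotopy.acyclicTorsion_cone_eq (H : Homotopy f f') (κ : (cone f).Contraction) :
    (cone f).acyclicTorsion = (cone f').acyclicTorsion := by
  have h0 : f.line f' 0 = f := by
    cases f
    simp [Hom.line]
  have h1 : f.line f' 1 = f' := by
    cases f'
    simp [Hom.line]
  -- The cones of all maps on the line from `f` to `f'` are the cone of `f` with a varying
  -- differential; the parameters 0 and 1 give the two ends.
  have h := (cone f).acyclicTorsion_withD_eq (d := fun t => (cone (f.line f' t)).d)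
    (fun t => (cone (f.line f' t)).d_d) (fun t => (cone (f.line f' t)).d_rep)
    (H.contraction κ) (fun n x => ?_) (fun n x => ?_) 0 1
  · refine (congrArg acyclicTorsion (congrArg cone h0)).symm.trans (Eq.trans h ?_)
    exact congrArg acyclicTorsion (congrArg cone h1)
  · refine withLpProd_mem_polynomialCurves (const_mem_polynomialCurves _) ?_
    exact sub_mem (add_mem (const_mem_polynomialCurves (f.shift n x.fst))
      (smul_mem_polynomialCurves
        (const_mem_polynomialCurves (f'.shift n x.fst - f.shift n x.fst))))
      (const_mem_polynomialCurves (Shift.d D n x.snd))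
  · exact H.shear_mem_polynomialCurves n (map_mem_polynomialCurves (κ.κ n)
      (H.shear_neg_mem_polynomialCurves (n + 1) x))

end Homotopy

end HilbertComplex

namespace HilbertComplex

theorem cls_eq_zero_iff {Γ : Type w} [Group Γ] {C : HilbertComplex.{u, w} Γ} {n : ℕ}
    (v : LinearMap.ker (C.d n)) : C.cls v = 0 ↔ (v : C.V n) ∈ C.boundaries n :=
  Submodule.Quotient.mk_eq_zero _

/-! ### Equivariant contractions, embeddings and homotopies. -/

section Existence

variable {Γ : Type w} [Group Γ] [Finite Γ] {C : HilbertComplex.{u, w} Γ}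

/-- An exact complex of `Γ`-Hilbert modules has an equivariant contraction. -/
theorem nonempty_contraction (h0 : Function.Injective (C.d 0))
    (h : ∀ n v, C.d (n + 1) v = 0 → ∃ w, C.d n w = v) : Nonempty C.Contraction := by
  let K : ∀ n, Subrepresentation (C.rep n) := fun n => ⟨LinearMap.ker (C.d n), C.rep_mem_ker n⟩
  let d : ∀ n, IntertwiningMap (C.rep n) (C.rep (n + 1)) := fun n =>
    ⟨C.d n, fun γ => LinearMap.ext fun v => C.d_rep n γ v⟩
  -- Exactness and averaging give equivariant sections $s$ of $d$ over the cocycles. Then $p=1-sd$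
  -- projects equivariantly onto the cocycles, and the contraction is $\kappa=sp$: one has
  -- $d\kappa=p$ and $\kappa d=sd$, since $pd=d$.
  have hs : ∀ n, ∃ s : IntertwiningMap (K (n + 1)).toRepresentation (C.rep n),
      ∀ v, C.d n (s v) = v := fun n =>
    exists_intertwining_lift (d n) (K (n + 1)).subtype fun v => h n v v.2
  choose s hs using hs
  let δ : ∀ n, IntertwiningMap (C.rep n) (K (n + 1)).toRepresentation := fun n =>
    ⟨(C.d n).codRestrict (K (n + 1)).toSubmodule fun v => C.d_d n v,
      fun γ => LinearMap.ext fun v => Subtype.ext (C.d_rep n γ v)⟩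
  have hp : ∀ n v, v - s (n + 1) (δ (n + 1) v) ∈ (K (n + 1)).toSubmodule := fun n v => by
    change C.d (n + 1) _ = 0
    rw [map_sub, hs, sub_eq_zero]
    rfl
  let p : ∀ n, C.V (n + 1) →ₗ[ℂ] (K (n + 1)).toSubmodule := fun n =>
    (LinearMap.id - (s (n + 1)).toLinearMap ∘ₗ (δ (n + 1)).toLinearMap).codRestrict _ (hp n)
  have hpd : ∀ n v, p n (C.d n v) = δ n v := fun n v => Subtype.ext (by
    have h1 : δ (n + 1) (C.d n v) = 0 := Subtype.ext (C.d_d n v)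
    change C.d n v - s (n + 1) (δ (n + 1) (C.d n v)) = C.d n v
    rw [h1, map_zero, sub_zero])
  have hpr : ∀ n γ v, p n (C.rep (n + 1) γ v) = (K (n + 1)).toRepresentation γ (p n v) :=
    fun n γ v => Subtype.ext (by
      change C.rep (n + 1) γ v - s (n + 1) (δ (n + 1) (C.rep (n + 1) γ v)) =
        C.rep (n + 1) γ (v - s (n + 1) (δ (n + 1) v))
      rw [map_sub, (δ (n + 1)).isIntertwining, (s (n + 1)).isIntertwining])
  exact ⟨{
    κ := fun n => (s n).toLinearMap ∘ₗ p n
    κ_rep := fun n γ v => by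
      change s n (p n _) = C.rep n γ (s n (p n v))
      rw [hpr, (s n).isIntertwining]
    zero := fun v => h0 (by
      change C.d 0 (s 0 (p 0 _)) = _
      rw [hs, hpd]
      rfl)
    succ := fun n v => by
      change C.d n (s n (p n v)) + s (n + 1) (p (n + 1) (C.d (n + 1) v)) = v
      rw [hs, hpd]
      exact sub_add_cancel _ _ }⟩

variable {h : ∀ n, InvariantInnerProduct (C.cohomologyRep n)}

variable (C) in
/-- The projection of cocycles onto cohomology, as an equivariant map. -/
def clsMap (n : ℕ) : IntertwiningMap
    (⟨LinearMap.ker (C.d n), C.rep_mem_ker n⟩ : Subrepresentation (C.rep n)).toRepresentation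
    (C.cohomologyRep n) where
  toLinearMap := Submodule.mkQ _
  isIntertwining' _ := rfl

-- Averaging yields an equivariant section of the projection from cocycles to classes.
variable (C h) in
theorem nonempty_embedding : Nonempty (C.Embedding h) := by
  have hs : ∀ n, ∃ s : IntertwiningMap (C.cohomologyRep n) (⟨LinearMap.ker (C.d n),
      C.rep_mem_ker n⟩ : Subrepresentation (C.rep n)).toRepresentation,
      ∀ a, C.cls (s a) = a := fun n =>
    exists_intertwining_lift (C.clsMap n) (IntertwiningMap.id _)
      fun a => Submodule.Quotient.mk_surjective _ a
  choose s hs using hs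
  exact ⟨{
    f := fun n => Submodule.subtype _ ∘ₗ (s n).toLinearMap
    f_rep := fun n γ a => congrArg Subtype.val ((s n).isIntertwining _ _ γ a)
    comm := fun n a => (show C.d n (s n a) = 0 from (s n a).2).trans
      (congrArg Subtype.val (map_zero (s (n + 1)))).symm
    injective := fun n a b hab => by
      rw [← hs n a, ← hs n b]
      exact congrArg C.cls (Subtype.ext hab)
    cls_eq := fun n a => ⟨(s n a).2, hs n a⟩ }⟩

/-- The cone is exact. If $(x,z)$ is a cocycle, then $ix=dz$ is a coboundary, so $x=0$ and $dz=0$.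
As $i[z]$ and $z$ are cohomologous, $dy=i[z]-z$ for some $y$, and $([z],y)$ has differential
$(0,i[z]-dy)=(0,z)$ because the cohomology complex has zero differential. -/
theorem nonempty_contraction_cone (i : C.Embedding h) :
    Nonempty (cone i.toHom).Contraction := by
  have hi : ∀ n a, i.f n a ∈ C.boundaries n → a = 0 := fun n a ha => by
    obtain ⟨h1, h2⟩ := i.cls_eq n a
    rw [← h2]
    exact (cls_eq_zero_iff ⟨_, h1⟩).2 ha
  refine nonempty_contraction ((injective_iff_map_eq_zero _).2 fun x hx => ?_) fun n x hx => ?_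
  · have h1 : i.f 0 x.fst - (0 : C.V 0) = 0 := congrArg WithLp.snd hx
    rw [sub_zero] at h1
    refine prod_ext (hi 0 x.fst ?_) (Subsingleton.elim (α := PUnit) _ _)
    rw [h1]
    exact zero_mem _
  · obtain ⟨z, hz⟩ : ∃ z : C.V n, z = x.snd := ⟨_, rfl⟩
    have h1 : i.f (n + 1) x.fst - C.d n z = 0 := by
      rw [hz]
      exact congrArg WithLp.snd hx
    have h2 : x.fst = 0 := hi (n + 1) x.fst (by
      rw [sub_eq_zero.1 h1]
      exact ⟨_, rfl⟩)
    have h3 : C.d n z = 0 := by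
      rw [h2, map_zero, zero_sub, neg_eq_zero] at h1
      exact h1
    obtain ⟨h4, h5⟩ := i.cls_eq n (C.cls ⟨z, h3⟩)
    have h6 : i.f n (C.cls ⟨z, h3⟩) - z ∈ C.boundaries n := by
      refine (cls_eq_zero_iff ⟨_, sub_mem h4 (LinearMap.mem_ker.2 h3)⟩).1 ?_
      exact (Submodule.Quotient.mk_sub _).trans (sub_eq_zero.2 h5)
    obtain ⟨y, hy⟩ : ∃ y : C.Shift n, Shift.d C n y = i.f n (C.cls ⟨z, h3⟩) - z := by
      cases n with
      | zero => exact ⟨0, (map_zero (Shift.d C 0)).trans (show _ = (0 : C.V 0) from h6).symm⟩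
      | succ n => exact h6
    refine ⟨WithLp.toLp 2 (C.cls ⟨z, h3⟩, y), prod_ext h2.symm ?_⟩
    exact (congrArg (fun q : C.V n => i.f n (C.cls ⟨z, h3⟩) - q) hy).trans
      ((sub_sub_cancel _ _).trans hz)

/-- The difference $i'-i$ takes values in coboundaries, so it lifts equivariantly through $d$.
Because the differential of the cohomology complex is zero, the homotopy equation is just $dh=i'-i$.
-/
theorem nonempty_homotopy (i i' : C.Embedding h) : Nonempty (Homotopy i.toHom i'.toHom) := by
  let d : ∀ n, IntertwiningMap (Shift.rep C n) (C.rep n) := fun n =>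
    ⟨Shift.d C n, fun γ => LinearMap.ext fun v => Shift.d_rep C n γ v⟩
  let e : ∀ n, IntertwiningMap (C.cohomologyRep n) (C.rep n) := fun n =>
    ⟨i'.f n - i.f n, fun γ => LinearMap.ext fun v => by
      have h1 := i.f_rep n γ v
      have h2 := i'.f_rep n γ v
      change i'.f n (C.cohomologyRep n γ v) - i.f n (C.cohomologyRep n γ v) =
        C.rep n γ (i'.f n v - i.f n v)
      rw [map_sub, ← h1, ← h2]
      rfl⟩
  have hl : ∀ n, ∃ l : IntertwiningMap (C.cohomologyRep n) (Shift.rep C n),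
      ∀ a, d n (l a) = e n a := by
    refine fun n => exists_intertwining_lift (d n) (e n) fun a => ?_
    obtain ⟨h1, h2⟩ := i.cls_eq n a
    obtain ⟨h1', h2'⟩ := i'.cls_eq n a
    have h6 : i'.f n a - i.f n a ∈ C.boundaries n := by
      refine (cls_eq_zero_iff ⟨_, sub_mem h1' h1⟩).1 ?_
      exact (Submodule.Quotient.mk_sub _).trans (sub_eq_zero.2 (h2'.trans h2.symm))
    cases n with
    | zero => exact ⟨0, (map_zero (d 0)).trans (show _ = (0 : C.V 0) from h6).symm⟩
    | succ n => exact h6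
  choose l hl using hl
  exact ⟨{
    h := fun n => (l n).toLinearMap
    h_rep := fun n γ v => (l n).isIntertwining _ _ γ v
    comm := fun n v => by
      refine (congrArg (_ + ·) (map_zero (l (n + 1)))).trans ((add_zero _).trans ?_)
      exact hl n v }⟩

/-- Frees the torsion from the embedding picked in its definition. -/
theorem torsion_eq (i : C.Embedding h) : C.torsion h = -(cone i.toHom).acyclicTorsion := by
  have hi : Nonempty (C.Embedding h) := ⟨i⟩
  rw [torsion, dif_pos hi]
  obtain ⟨H⟩ := nonempty_homotopy hi.some i
  obtain ⟨κ⟩ := nonempty_contraction_cone hi.some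
  rw [H.acyclicTorsion_cone_eq κ]

end Existence

/-! ### Restriction of the torsion of complexes. -/

section Restriction

variable {Γ : Type w} [Group Γ] (Γ' : Subgroup Γ)

/-- A contraction, as a contraction of the restricted complex. -/
def Contraction.res {C : HilbertComplex.{u, w} Γ} (κ : C.Contraction) :
    (C.res Γ').Contraction where
  κ := κ.κ
  κ_rep n γ := κ.κ_rep n γ
  zero := κ.zero
  succ := κ.succ

/-- A chain map, as a chain map of the restricted complexes. -/
def Hom.res {C D : HilbertComplex.{u, w} Γ} (f : C.Hom D) : (C.res Γ').Hom (D.res Γ') where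
  f := f.f
  f_rep n γ := f.f_rep n γ
  comm := f.comm

theorem Shift.rep_res (D : HilbertComplex.{u, w} Γ) (n : ℕ) (γ : Γ') (v : D.Shift n) :
    Shift.rep (D.res Γ') n γ v = Shift.rep D n γ v := by
  cases n <;> rfl

open scoped InnerProductSpace in
/-- The complex with the same modules and another representation. -/
def withRep (K : HilbertComplex.{u, w} Γ) {Γ₀ : Type w} [Group Γ₀]
    (rep : ∀ n, Representation ℂ Γ₀ (K.V n))
    (hi : ∀ n γ (v w : K.V n), ⟪rep n γ v, rep n γ w⟫_ℂ = ⟪v, w⟫_ℂ)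
    (hr : ∀ n γ v, K.d n (rep n γ v) = rep (n + 1) γ (K.d n v)) : HilbertComplex.{u, w} Γ₀ where
  V := K.V
  rep := rep
  inner_rep := hi
  d := K.d
  d_d := K.d_d
  d_rep := hr
  len := K.len
  subsingleton := K.subsingleton

/-- Both complexes have the same modules and differentials. Their representations agree only after
distinguishing degree zero in the shift, so the equality is obtained by replacing the representation
inside `withRep`, where all that depends on it are proofs. -/
theorem cone_res {C D : HilbertComplex.{u, w} Γ} (f : C.Hom D) :
    cone (f.res Γ') = (cone f).res Γ' := by
  have key : ∀ (rep rep' : ∀ n, Representation ℂ Γ' ((cone f).V n)) (_ : rep = rep') hi hr hi' hr',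
      (cone f).withRep rep hi hr = (cone f).withRep rep' hi' hr' := by
    rintro rep _ rfl _ _ _ _
    rfl
  refine key (cone (f.res Γ')).rep ((cone f).res Γ').rep (funext fun n => MonoidHom.ext fun γ =>
    LinearMap.ext fun x => prod_ext rfl (Shift.rep_res Γ' D n γ x.snd))
    (cone (f.res Γ')).inner_rep (cone (f.res Γ')).d_rep
    ((cone f).res Γ').inner_rep ((cone f).res Γ').d_rep

open scoped InnerProductSpace in
theorem inner_sumRep {ι : Type*} [Fintype ι] {V : ι → Type u} [∀ i, NormedAddCommGroup (V i)]
    [∀ i, InnerProductSpace ℂ (V i)] (rep : ∀ i, Representation ℂ Γ (V i))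
    (h : ∀ i γ (v w : V i), ⟪rep i γ v, rep i γ w⟫_ℂ = ⟪v, w⟫_ℂ) (γ : Γ) (v w : PiLp 2 V) :
    ⟪sumRep rep γ v, sumRep rep γ w⟫_ℂ = ⟪v, w⟫_ℂ := by
  rw [PiLp.inner_apply, PiLp.inner_apply]
  exact Finset.sum_congr rfl fun i _ => h i γ _ _

/-- A $\Gamma$-contraction is also a $\Gamma'$-contraction and gives the same linear map $c+\kappa$;
independence of the contraction reduces the claim to `res_logDetClass`. -/
theorem res_acyclicTorsion [Finite Γ] {C : HilbertComplex.{u, w} Γ} (κ : C.Contraction) :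
    ClassFunction.res Γ' C.acyclicTorsion = (C.res Γ').acyclicTorsion := by
  rw [acyclicTorsion_eq κ, acyclicTorsion_eq (κ.res Γ')]
  exact res_logDetClass Γ' (inner_sumRep (ι := Fin C.len) _ fun k => C.inner_rep (2 * k))
    (inner_sumRep (ι := Fin C.len) _ fun k => C.inner_rep (2 * k + 1)) (fun _ => rfl) (fun _ => rfl)
    (C.evOdd κ) ((C.res Γ').evOdd (κ.res Γ')) rfl (injective_evOdd κ)

variable (C : HilbertComplex.{u, w} Γ)
  (h : ∀ n, InvariantInnerProduct (C.cohomologyRep n))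

/-- The restriction of an invariant inner product on the cohomology of a complex. -/
def resInner {n : ℕ} (h : InvariantInnerProduct (C.cohomologyRep n)) :
    InvariantInnerProduct ((C.res Γ').cohomologyRep n) where
  core := h.core
  inner_rep γ := h.inner_rep (γ : Γ)

/-- The torsion of complexes is compatible with restriction to a subgroup. -/
theorem res_torsion [Finite Γ] : ClassFunction.res Γ' (C.torsion h) =
    (C.res Γ').torsion fun n => C.resInner Γ' (h n) := by
  obtain ⟨i⟩ := C.nonempty_embedding h
  obtain ⟨κ⟩ := nonempty_contraction_cone i
  -- The embedding used for `Γ` is also one for `Γ'`, and by `torsion_eq` it may be used there.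
  let i' : (C.res Γ').Embedding fun n => C.resInner Γ' (h n) :=
    { f := i.f
      f_rep := fun n γ => i.f_rep n γ
      comm := i.comm
      injective := i.injective
      cls_eq := i.cls_eq }
  rw [torsion_eq i, torsion_eq i']
  have h1 : (cone i'.toHom).acyclicTorsion = ((cone i.toHom).res Γ').acyclicTorsion :=
    congrArg acyclicTorsion (cone_res Γ' i.toHom)
  rw [h1, ← res_acyclicTorsion Γ' κ]
  rfl

end Restriction

end HilbertComplex

/-! ### Restriction of the Reidemeister torsion of spaces. -/

/-- The isomorphisms `θ` and `θ'` are kept as separate variables because in the application they are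
picked independently and are equal only by uniqueness. -/
theorem HilbertComplex.resInner_transport {Γ : Type w} [Group Γ] (Γ' : Subgroup Γ)
    (C : HilbertComplex.{u, w} Γ) {n : ℕ} {H : Type u} [AddCommGroup H] [Module ℂ H]
    {ρ : Representation ℂ Γ H} {ρ' : Representation ℂ Γ' H} (h : InvariantInnerProduct ρ)
    (hi : ∀ γ v w, h.core.inner (ρ' γ v) (ρ' γ w) = h.core.inner v w)
    {θ : H ≃ₗ[ℂ] C.Cohomology n} {θ' : H ≃ₗ[ℂ] (C.res Γ').Cohomology n} (hθθ : θ' = θ)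
    (hθ : ∀ γ v, θ (ρ γ v) = C.cohomologyRep n γ (θ v))
    (hθ' : ∀ γ v, θ' (ρ' γ v) = (C.res Γ').cohomologyRep n γ (θ' v)) :
    C.resInner Γ' (h.transport θ hθ) =
      (⟨h.core, hi⟩ : InvariantInnerProduct ρ').transport θ' hθ' := by
  subst hθθ
  rfl

set_option maxHeartbeats 400000 in
/-- The Reidemeister torsion of a space is compatible with restriction to a subgroup. -/
theorem mainTheorem11 {Γ : Type w} [Group Γ] [Finite Γ] (Γ' : Subgroup Γ)
    {X : Type u} [TopologicalSpace X] [MulAction Γ X] [ContinuousConstSMul Γ X]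
    (S : SimpleStructure Γ X) (F : HilbertLocalSystem.{u, v} X) (E : F.EquivariantStructure Γ)
    (h : ∀ n, InvariantInnerProduct (E.cohomologyRep n)) :
    ClassFunction.res Γ' (reidemeisterTorsion S E h) =
      reidemeisterTorsion (S.res Γ') (E.res Γ') (fun n => (h n).res Γ') := by
  -- The condition on the canonical map involves cochains, cocycles and evaluation on cells, but not
  -- the group action.
  have hiff : ∀ n, (∃ θ : F.Cohomology n ≃ₗ[ℂ] (S.cochainComplex E).Cohomology n,
      S.IsCanonical E θ ∧ ∀ θ', S.IsCanonical E θ' → θ' = θ) ↔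
      ∃ θ : F.Cohomology n ≃ₗ[ℂ] ((S.res Γ').cochainComplex (E.res Γ')).Cohomology n,
        (S.res Γ').IsCanonical (E.res Γ') θ ∧
          ∀ θ', (S.res Γ').IsCanonical (E.res Γ') θ' → θ' = θ := fun n => Iff.rfl
  by_cases hc : ∀ n, ∃ θ : F.Cohomology n ≃ₗ[ℂ] (S.cochainComplex E).Cohomology n,
      S.IsCanonical E θ ∧ ∀ θ', S.IsCanonical E θ' → θ' = θ
  · have hc' := fun n => (hiff n).1 (hc n)
    rw [reidemeisterTorsion, dif_pos hc, reidemeisterTorsion, dif_pos hc']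
    -- The cellular complex of the restricted data is by definition the restriction of the cellular
    -- complex, so only the inner products on cohomology remain to be compared.
    refine ((S.cochainComplex E).res_torsion Γ' _).trans ?_
    refine congrArg ((S.cochainComplex E).res Γ').torsion (funext fun n => ?_)
    -- The map picked for `Γ'` is canonical for `Γ` as well, hence equal to the one picked for `Γ`.
    have hθ := (hc n).choose_spec.2 _ (hc' n).choose_spec.1
    have h1 := (hc n).choose_spec.1.equivariant S E (hc n).choose_spec.2
    have h2 := (hc' n).choose_spec.1.equivariant (S.res Γ') (E.res Γ') (hc' n).choose_spec.2
    have hi := ((h n).res Γ').inner_rep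
    have key := (S.cochainComplex E).resInner_transport Γ'
      (ρ' := (E.res Γ').cohomologyRep n) (h n) hi hθ h1 h2
    exact key
  -- Without a unique canonical map both torsions take the default value 0.
  · have hc' := mt (forall_congr' hiff).2 hc
    rw [reidemeisterTorsion, dif_neg hc, reidemeisterTorsion, dif_neg hc']
    rfl

end
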